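/- **Hausdorff–Young inequality for operators.** Let $d$ be a natural number and write points of $\mathbb{R}^{2d}$ as $z=(x,\omega)$ with $x,\omega\in\mathbb{R}^d$. For $z\in\mathbb{R}^{2d}$ let $\pi(z)$ be the time-frequency shift on $L^2(\mathbb{R}^d)$, $\pi(z)\psi(t)=e^{2\pi i\omega\cdot t}\psi(t-x)$. For $1\le p<\infty$ let $\mathcal{T}^p$ be the Schatten $p$-class of $L^2(\mathbb{R}^d)$, i.e. the compact operators whose sequence of singular values (counted with multiplicity) lies in $\ell^p$, and let $\|S\|_{\mathcal{T}^p}$ be the $\ell^p$-norm of the singular values of $S$. The Fourier–Wigner transform of $S\in\mathcal{T}^1$ is the function $$\mathcal{F}_W S(z)=e^{-\pi i x\cdot\omega}\,\mathrm{tr}(\pi(-z)S),\qquad z\in\mathbb{R}^{2d},$$ and for $S\in\mathcal{T}^2$ the transform $\mathcal{F}_W S\in L^2(\mathbb{R}^{2d})$ is defined by continuous extension: $\mathcal{F}_WS$ is the limit in $L^2(\mathbb{R}^{2d})$ of $\mathcal{F}_W T_n$ for trace class operators $T_n$ with $\|T_n-S\|_{\mathcal{T}^2}\to0$ for which this limit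 exists. Let $1\le p\le 2$, let $q\in[2,\infty]$ be determined by $\frac1p+\frac1q=1$, and let $S\in\mathcal{T}^p$. Then $\mathcal{F}_WS$ is well defined (such a limit exists, and it is unique up to equality almost everywhere; if $S\in\mathcal{T}^1$ it is given by the trace formula), $\mathcal{F}_WS\in L^q(\mathbb{R}^{2d})$, and $$\|\mathcal{F}_WS\|_{L^q(\mathbb{R}^{2d})}\le\|S\|_{\mathcal{T}^p}.$$ -/

import Mathlib

open MeasureTheory Filter Topology
open scoped ENNReal

noncomputable section

namespace FourierWigner

/-- The configuration space `ℝ^d`, with its Euclidean structure. -/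
abbrev Config (d : ℕ) : Type := EuclideanSpace ℝ (Fin d)

/-- Phase space `ℝ^{2d}`, whose points are written `z = (x, ω)`. -/
abbrev Phase (d : ℕ) : Type := Config d × Config d

/-- The Hilbert space `L²(ℝ^d)` of complex-valued functions. -/
abbrev L2 (d : ℕ) : Type := Lp ℂ 2 (volume : Measure (Config d))

/-- Bounded linear operators on `L²(ℝ^d)`. -/
abbrev Op (d : ℕ) : Type := L2 d →L[ℂ] L2 d

section Schatten

variable {H : Type*} [NormedAddCommGroup H] [InnerProductSpace ℂ H] [CompleteSpace H]

/-- The multiplicity of `s > 0` as a singular value of a compact operator `T`, i.e. the multiplicity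
of `s` as an eigenvalue of `|T| = (T* T)^{1/2}`, which is that of `s ^ 2` as an eigenvalue of
`T* T`. For compact `T` and `s > 0` the eigenspace is finite-dimensional. -/
def singularValueMultiplicity (T : H →L[ℂ] H) (s : ℝ) : ℕ :=
  Module.finrank ℂ
    (Module.End.eigenspace
      ((ContinuousLinearMap.adjoint T ∘L T : H →L[ℂ] H) : H →ₗ[ℂ] H) ((s : ℂ) ^ 2))

open Classical in
/-- The Schatten `p`-norm (`0 < p < ∞`) with values in `[0, ∞]`: the `ℓ^p` norm of the singular
values of `T`, counted with multiplicity, if `T` is compact, and `∞` otherwise. -/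
def schattenENorm (p : ℝ) (T : H →L[ℂ] H) : ℝ≥0∞ :=
  if IsCompactOperator T then
    (∑' s : Set.Ioi (0 : ℝ),
      (singularValueMultiplicity T s : ℝ≥0∞) * ENNReal.ofReal (s : ℝ) ^ p) ^ (1 / p)
  else ∞

/-- `T` belongs to the Schatten class `𝒯^p`: it is compact and its singular values are in `ℓ^p`. -/
def MemSchatten (p : ℝ) (T : H →L[ℂ] H) : Prop :=
  schattenENorm p T < ∞

/-- The trace `∑ ⟨T eₙ, eₙ⟩` of a trace class operator, along some orthonormal basis. The inner
product of Mathlib is antilinear in its first argument. -/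
def trace (T : H →L[ℂ] H) : ℂ :=
  ∑' i, inner ℂ ((exists_hilbertBasis ℂ H).choose_spec.choose i)
    (T ((exists_hilbertBasis ℂ H).choose_spec.choose i))

end Schatten

section TimeFrequency

variable {d : ℕ}

/-- The function `t ↦ e^{2πi ω·t} ψ(t - x)`, for `z = (x, ω)`. -/
def shiftFun (z : Phase d) (ψ : Config d → ℂ) (t : Config d) : ℂ :=
  Complex.exp (2 * Real.pi * Complex.I * (inner ℝ z.2 t : ℝ)) * ψ (t - z.1)

theorem norm_shiftFun (z : Phase d) (ψ : Config d → ℂ) (t : Config d) :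
    ‖shiftFun z ψ t‖ = ‖ψ (t - z.1)‖ := by
  have h : (2 * Real.pi * Complex.I * (inner ℝ z.2 t : ℝ) : ℂ)
      = ((2 * Real.pi * inner ℝ z.2 t : ℝ) : ℂ) * Complex.I := by
    push_cast; ring
  rw [shiftFun, norm_mul, h, Complex.norm_exp_ofReal_mul_I, one_mul]

theorem measurePreserving_sub_fst (z : Phase d) :
    MeasurePreserving (fun t : Config d => t - z.1) volume volume :=
  measurePreserving_sub_right volume z.1

theorem aestronglyMeasurable_shiftFun (z : Phase d) {ψ : Config d → ℂ}
    (hψ : AEStronglyMeasurable ψ volume) : AEStronglyMeasurable (shiftFun z ψ) volume := by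
  refine AEStronglyMeasurable.mul ?_
    (hψ.comp_measurePreserving (measurePreserving_sub_fst z))
  exact Continuous.aestronglyMeasurable (by fun_prop)

theorem eLpNorm_shiftFun (z : Phase d) {ψ : Config d → ℂ}
    (hψ : AEStronglyMeasurable ψ volume) :
    eLpNorm (shiftFun z ψ) 2 volume = eLpNorm ψ 2 volume := by
  rw [eLpNorm_congr_norm_ae (g := ψ ∘ fun t => t - z.1)
    (Eventually.of_forall fun t => norm_shiftFun z ψ t)]
  exact eLpNorm_comp_measurePreserving hψ (measurePreserving_sub_fst z)

theorem memLp_shiftFun (z : Phase d) (ψ : L2 d) : MemLp (shiftFun z ψ) 2 volume :=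
  ⟨aestronglyMeasurable_shiftFun z (Lp.aestronglyMeasurable ψ), by
    rw [eLpNorm_shiftFun z (Lp.aestronglyMeasurable ψ)]; exact Lp.eLpNorm_lt_top ψ⟩

theorem shiftFun_congr (z : Phase d) {ψ φ : Config d → ℂ} (h : ψ =ᵐ[volume] φ) :
    shiftFun z ψ =ᵐ[volume] shiftFun z φ := by
  have h' := (measurePreserving_sub_fst z).quasiMeasurePreserving.ae_eq_comp h
  filter_upwards [h'] with t ht
  simp only [Function.comp_apply] at ht
  simp only [shiftFun, ht]

/-- The time-frequency shift `π(z) = M_ω T_x` on `L²(ℝ^d)`, for `z = (x, ω)`: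
`(π(z) ψ)(t) = e^{2πi ω·t} ψ(t - x)`. -/
def timeFreqShift (z : Phase d) : Op d :=
  LinearMap.mkContinuous
    { toFun := fun ψ => (memLp_shiftFun z ψ).toLp (shiftFun z ψ)
      map_add' := fun ψ φ => by
        rw [← MemLp.toLp_add, MemLp.toLp_eq_toLp_iff]
        refine (shiftFun_congr z (Lp.coeFn_add ψ φ)).trans (Eventually.of_forall fun t => ?_)
        simp only [shiftFun, Pi.add_apply, mul_add]
      map_smul' := fun c ψ => by
        rw [RingHom.id_apply, ← MemLp.toLp_const_smul, MemLp.toLp_eq_toLp_iff]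
        refine (shiftFun_congr z (Lp.coeFn_smul c ψ)).trans (Eventually.of_forall fun t => ?_)
        simp only [shiftFun, Pi.smul_apply, smul_eq_mul]
        ring }
    1 (fun ψ => by
      simp only [LinearMap.coe_mk, AddHom.coe_mk, one_mul, Lp.norm_toLp]
      rw [eLpNorm_shiftFun z (Lp.aestronglyMeasurable ψ), Lp.norm_def])

/-- The Fourier-Wigner transform of a trace class operator,
`ℱ_W S (z) = e^{-πi x·ω} tr(π(-z) S)` for `z = (x, ω)`. -/
def fourierWigner (S : Op d) (z : Phase d) : ℂ :=
  Complex.exp (-(Real.pi * Complex.I * (inner ℝ z.1 z.2 : ℝ))) * trace (timeFreqShift (-z) ∘L S)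

/-- `F` represents the Fourier-Wigner transform of the Hilbert-Schmidt operator `S`, where the
transform is extended by continuity from `𝒯^1` to an operator `𝒯^2 → L²(ℝ^{2d})`: there are trace
class operators converging to `S` in `𝒯^2` whose Fourier-Wigner transforms converge to `F` in
`L²(ℝ^{2d})`. -/
def IsFourierWigner (S : Op d) (F : Phase d → ℂ) : Prop :=
  MemLp F 2 volume ∧ ∃ T : ℕ → Op d, (∀ n, MemSchatten 1 (T n)) ∧
    Tendsto (fun n => schattenENorm 2 (T n - S)) atTop (𝓝 0) ∧
    Tendsto (fun n => eLpNorm (fourierWigner (T n) - F) 2 volume) atTop (𝓝 0)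

end TimeFrequency

end FourierWigner

end

/-! A singular value decomposition `S = ∑ s i ⟨e i, ·⟩ f i` turns the inequality into a statement
about one series of functions. The transform of the rank one operator `⟨h, ·⟩ g` is the ambiguity
function of `g` and `h`. It is bounded by `‖g‖ ‖h‖`, and Moyal's identity (`inner_ambiguityLp`)
makes its inner products those of rank one operators in the Hilbert–Schmidt space. So the functions
`φ i = ambiguity (f i) (e i)` are orthonormal in `L²` and bounded by one. The claim becomes F.
Riesz's theorem `‖∑ s i φ i‖_q ≤ ‖s‖_p`, proved for finite sums by the three lines theorem
(`norm_sum_le_of_bilinear_bounds`, `lintegral_enorm_sum_rpow_le`). Only scalar coefficients are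
interpolated, not Schatten classes. Fatou's lemma along an almost everywhere convergent subsequence
of the partial sums gives the full series.

For well-definedness, the equality of Gram matrices shows that the transform of differences of trace
class operators is isometric from the Hilbert–Schmidt norm to `L²`. Limits therefore do not depend
on the approximating sequence. Existence follows from the finite partial sums of the decomposition,
since `p ≤ 2` makes the singular values square summable. -/

open MeasureTheory Filter Topology
open scoped ENNReal

noncomputable section

namespace FourierWigner

/-! ### Orthonormal expansions and rank one operators in the Hilbert–Schmidt space. -/

section Hilbert

variable {H : Type*} [NormedAddCommGroup H] [InnerProductSpace ℂ H]

theorem enorm_sq_eq_ofReal {E : Type*} [NormedAddCommGroup E] (z : E) :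
    ‖z‖ₑ ^ 2 = ENNReal.ofReal (‖z‖ ^ 2) := by
  rw [← ofReal_norm, ENNReal.ofReal_pow (norm_nonneg _)]

theorem enorm_sq_eq_tsum_of_hasSum {ι : Type*} {f : ι → H} (hf : Orthonormal ℂ f) {c : ι → ℂ}
    {y : H} (h : HasSum (fun i => c i • f i) y) : ‖y‖ₑ ^ 2 = ∑' i, ‖c i‖ₑ ^ 2 := by
  have h1 : HasSum (fun i => ‖c i‖ ^ 2) (‖y‖ ^ 2) := by
    have h2 := (h.norm).pow 2
    refine h2.congr fun s => ?_
    have := hf.orthogonalFamily.norm_sum c s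
    simpa using this
  simp_rw [enorm_sq_eq_ofReal]
  rw [← ENNReal.ofReal_tsum_of_nonneg (fun i => by positivity) h1.summable, h1.tsum_eq]

theorem enorm_sq_eq_tsum_hilbertBasis {κ : Type*} (b : HilbertBasis κ ℂ H) (x : H) :
    ‖x‖ₑ ^ 2 = ∑' n, ‖inner ℂ x (b n)‖ₑ ^ 2 := by
  rw [enorm_sq_eq_tsum_of_hasSum b.orthonormal (b.hasSum_repr x)]
  refine tsum_congr fun n => ?_
  rw [b.repr_apply_apply, ← inner_conj_symm, RCLike.enorm_conj]

/-- Parseval in the system `f`, Tonelli, then Parseval for each `e i` in the basis `b`. All sums are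
in `[0, ∞]`, so no square summability of `c` is required. -/
theorem tsum_enorm_sq_eq_of_hasSum {ι κ : Type*} (b : HilbertBasis κ ℂ H) {e f : ι → H}
    (he : Orthonormal ℂ e) (hf : Orthonormal ℂ f) {c : ι → ℂ} {R : H → H}
    (hR : ∀ x, HasSum (fun i => (c i * inner ℂ (e i) x) • f i) (R x)) :
    ∑' n, ‖R (b n)‖ₑ ^ 2 = ∑' i, ‖c i‖ₑ ^ 2 := by
  calc ∑' n, ‖R (b n)‖ₑ ^ 2 = ∑' n, ∑' i, ‖c i‖ₑ ^ 2 * ‖inner ℂ (e i) (b n)‖ₑ ^ 2 := by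
        refine tsum_congr fun n => ?_
        rw [enorm_sq_eq_tsum_of_hasSum hf (hR (b n))]
        exact tsum_congr fun i => by rw [enorm_mul, mul_pow]
    _ = ∑' i, ‖c i‖ₑ ^ 2 := by
        rw [ENNReal.tsum_comm]
        refine tsum_congr fun i => ?_
        rw [ENNReal.tsum_mul_left, ← enorm_sq_eq_tsum_hilbertBasis b, ← ofReal_norm (e i),
          he.1 i]
        simp

/-- Two absolutely summable families with the same Gram matrix have sums of the same norm. -/
theorem norm_tsum_eq_of_inner_eq {κ K L : Type*} [NormedAddCommGroup K] [InnerProductSpace ℂ K]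
    [NormedAddCommGroup L] [InnerProductSpace ℂ L] {u : κ → K} {v : κ → L}
    (huv : ∀ i j, inner ℂ (u i) (u j) = inner ℂ (v i) (v j)) (hu : Summable u)
    (hv : Summable v) : ‖∑' k, u k‖ = ‖∑' k, v k‖ := by
  have h : ∀ s : Finset κ, ‖∑ k ∈ s, u k‖ = ‖∑ k ∈ s, v k‖ := fun s => by
    rw [@norm_eq_sqrt_re_inner ℂ, @norm_eq_sqrt_re_inner ℂ L]
    simp only [sum_inner, inner_sum, huv]
  refine tendsto_nhds_unique hu.hasSum.norm ?_
  exact (tendsto_congr h).2 hv.hasSum.norm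

theorem isCompactOperator_of_finiteDimensional_range {T : H →L[ℂ] H}
    (hT : FiniteDimensional ℂ (LinearMap.range (T : H →ₗ[ℂ] H))) : IsCompactOperator T := by
  let T' : H →L[ℂ] LinearMap.range (T : H →ₗ[ℂ] H) :=
    T.codRestrict _ fun x => LinearMap.mem_range_self _ x
  have : ProperSpace (LinearMap.range (T : H →ₗ[ℂ] H)) := FiniteDimensional.proper ℂ _
  have h : IsCompactOperator T' := isCompactOperator_of_locallyCompactSpace_dom T'
  exact h.clm_comp (Submodule.subtypeL _)

/-- The rank one operator `x ↦ ⟨h, x⟩ g`, as the square summable family of its values on a Hilbert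
basis. -/
def rankOneLp {κ : Type*} (b : HilbertBasis κ ℂ H) (g h : H) : lp (fun _ : κ => H) 2 :=
  ⟨fun n => inner ℂ h (b n) • g, by
    refine memℓp_gen ?_
    have h1 := (lp.memℓp (b.repr h)).summable (by simp)
    refine (h1.mul_right (‖g‖ ^ (2 : ℝ≥0∞).toReal)).congr fun n => ?_
    rw [b.repr_apply_apply, norm_smul, norm_inner_symm, Real.mul_rpow] <;> positivity⟩

theorem rankOneLp_apply {κ : Type*} (b : HilbertBasis κ ℂ H) (g h : H) (n : κ) :
    rankOneLp b g h n = inner ℂ h (b n) • g := rfl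

/-- Parseval for `h'` and `h`. The right side is also that of `inner_ambiguityLp`, which is what
makes the transform isometric. -/
theorem inner_rankOneLp {κ : Type*} (b : HilbertBasis κ ℂ H) (g h g' h' : H) :
    inner ℂ (rankOneLp b g h) (rankOneLp b g' h') = inner ℂ g g' * inner ℂ h' h := by
  rw [lp.inner_eq_tsum, ← b.tsum_inner_mul_inner h' h, ← tsum_mul_left]
  refine tsum_congr fun n => ?_
  simp only [rankOneLp_apply, inner_smul_left, inner_smul_right, inner_conj_symm]
  ring

theorem norm_rankOneLp {κ : Type*} (b : HilbertBasis κ ℂ H) (g h : H) :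
    ‖rankOneLp b g h‖ = ‖g‖ * ‖h‖ := by
  have h1 : ((‖rankOneLp b g h‖ : ℝ) : ℂ) ^ 2 = ((‖g‖ * ‖h‖ : ℝ) : ℂ) ^ 2 := by
    have := inner_rankOneLp b g h g h
    simp only [inner_self_eq_norm_sq_to_K] at this
    push_cast
    rw [mul_pow]
    exact this
  exact (pow_left_inj₀ (norm_nonneg _) (by positivity) two_ne_zero).1 (by exact_mod_cast h1)

theorem enorm_sq_eq_tsum_lp {κ E : Type*} [NormedAddCommGroup E] (u : lp (fun _ : κ => E) 2) :
    ‖u‖ₑ ^ 2 = ∑' n, ‖u n‖ₑ ^ 2 := by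
  have h1 := lp.hasSum_norm (p := 2) (by simp) u
  simp only [ENNReal.toReal_ofNat, Real.rpow_ofNat] at h1
  simp_rw [enorm_sq_eq_ofReal]
  rw [← h1.tsum_eq, ENNReal.ofReal_tsum_of_nonneg (fun i => by positivity) h1.summable]

/-- The Hilbert-Schmidt norm of a nuclear operator `∑ ⟨h k, ·⟩ g k`. -/
theorem tsum_enorm_sq_eq_enorm_tsum_rankOneLp {κ ι : Type*} (b : HilbertBasis κ ℂ H) {g h : ι → H}
    [CompleteSpace H] (hgh : Summable fun k => ‖g k‖ * ‖h k‖) {R : H → H}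
    (hR : ∀ x, HasSum (fun k => inner ℂ (h k) x • g k) (R x)) :
    Summable (fun k => rankOneLp b (g k) (h k)) ∧
    ∑' n, ‖R (b n)‖ₑ ^ 2 = ‖∑' k, rankOneLp b (g k) (h k)‖ₑ ^ 2 := by
  have hs : Summable (fun k => rankOneLp b (g k) (h k)) :=
    Summable.of_norm (by simpa only [norm_rankOneLp] using hgh)
  refine ⟨hs, ?_⟩
  rw [enorm_sq_eq_tsum_lp]
  refine tsum_congr fun n => ?_
  have h1 := hs.hasSum.mapL (lp.evalCLM ℂ (fun _ : κ => H) 2 n)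
  have h2 : R (b n) = (∑' k, rankOneLp b (g k) (h k) : lp (fun _ : κ => H) 2) n :=
    (hR (b n)).unique h1
  rw [h2]

end Hilbert

/-! ### Singular value decomposition, Hilbert–Schmidt norm and trace. -/

section Schmidt

variable {H : Type*} [NormedAddCommGroup H] [InnerProductSpace ℂ H] [CompleteSpace H]

/-- A singular value decomposition of `T`, indexed so that each singular value `s > 0` occurs as
often as its multiplicity. -/
structure SchmidtDecomposition (T : H →L[ℂ] H) where
  /-- The index type. -/
  ι : Type
  /-- The singular values. -/
  s : ι → ℝ
  /-- The right singular vectors. -/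
  e : ι → H
  /-- The left singular vectors. -/
  f : ι → H
  pos : ∀ i, 0 < s i
  orthonormal_e : Orthonormal ℂ e
  orthonormal_f : Orthonormal ℂ f
  apply_e : ∀ i, T (e i) = (s i : ℂ) • f i
  hasSum : ∀ x, HasSum (fun i => ((s i : ℂ) * inner ℂ (e i) x) • f i) (T x)
  schattenENorm_eq : ∀ p : ℝ,
    schattenENorm p T = (∑' i, ENNReal.ofReal (s i) ^ p) ^ (1 / p)

theorem summable_inner_smul_of_orthonormal {ι : Type*} {e : ι → H} (he : Orthonormal ℂ e) (x : H) :
    Summable fun i => inner ℂ (e i) x • e i := by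
  have h := he.orthogonalFamily.summable_iff_norm_sq_summable (fun i => inner ℂ (e i) x)
  simp only [LinearIsometry.toSpanSingleton_apply] at h
  exact h.2 (he.inner_products_summable x)

theorem inner_adjoint_comp_self (T : H →L[ℂ] H) (x y : H) :
    inner ℂ x ((ContinuousLinearMap.adjoint T ∘L T) y) = inner ℂ (T x) (T y) := by
  rw [ContinuousLinearMap.comp_apply, ContinuousLinearMap.adjoint_inner_right]

theorem inner_adjoint_comp_self_left (T : H →L[ℂ] H) (x y : H) :
    inner ℂ ((ContinuousLinearMap.adjoint T ∘L T) x) y = inner ℂ (T x) (T y) := by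
  rw [ContinuousLinearMap.comp_apply, ContinuousLinearMap.adjoint_inner_left]

/-- A vector orthogonal to all eigenvectors of `T* T` for positive eigenvalues is in the kernel of
the compact operator `T`. -/
theorem apply_eq_zero_of_inner_eigenspace_eq_zero {T : H →L[ℂ] H} (hT : IsCompactOperator T)
    {y : H} (hy : ∀ s : ℝ, 0 < s → ∀ v ∈ Module.End.eigenspace
      ((ContinuousLinearMap.adjoint T ∘L T : H →L[ℂ] H) : H →ₗ[ℂ] H) ((s : ℂ) ^ 2),
      inner ℂ v y = 0) : T y = 0 := by
  set B : H →L[ℂ] H := ContinuousLinearMap.adjoint T ∘L T with hB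
  have hBc : IsCompactOperator B := hT.clm_comp (ContinuousLinearMap.adjoint T)
  have hBs : (B : H →ₗ[ℂ] H).IsSymmetric := fun x z => by
    change inner ℂ (B x) z = inner ℂ x (B z)
    rw [hB, inner_adjoint_comp_self, inner_adjoint_comp_self_left]
  have hbot := ContinuousLinearMap.orthogonalComplement_iSup_eigenspaces_eq_bot hBc hBs
  -- The vector `y` may have a component in the kernel, so orthogonality to all eigenspaces is shown
  -- for `B y`. An eigenvector `v` with `T v = 0` has `B v = 0`; otherwise its eigenvalue is the
  -- square of `‖T v‖ / ‖v‖ > 0` and `hy` applies.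
  have hBy : B y ∈ (⨆ μ, Module.End.eigenspace (B : H →ₗ[ℂ] H) μ)ᗮ := by
    rw [← Submodule.iInf_orthogonal, Submodule.mem_iInf]
    intro μ v hv
    have hv' : B v = μ • v := Module.End.mem_eigenspace_iff.1 hv
    have h1 : inner ℂ v (B y) = inner ℂ (B v) y := (hBs v y).symm
    rw [h1, hv', inner_smul_left]
    by_cases hTv : T v = 0
    · have : B v = 0 := by rw [hB, ContinuousLinearMap.comp_apply, hTv, map_zero]
      rw [← inner_smul_left, ← hv', this, inner_zero_left]
    · have hv0 : v ≠ 0 := fun h => hTv (by rw [h, map_zero])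
      have h2 : μ * (‖v‖ : ℂ) ^ 2 = (‖T v‖ : ℂ) ^ 2 := by
        have h3 := inner_adjoint_comp_self T v v
        rw [← hB, hv', inner_smul_right] at h3
        simpa using h3
      have hμ : μ = ((‖T v‖ / ‖v‖ : ℝ) : ℂ) ^ 2 := by
        have : (‖v‖ : ℂ) ≠ 0 := by simpa using hv0
        push_cast
        field_simp
        exact h2
      rw [hy (‖T v‖ / ‖v‖) (by positivity) v (by rw [← hμ]; exact hv), mul_zero]
  rw [hbot, Submodule.mem_bot] at hBy
  have := inner_adjoint_comp_self T y y
  rw [← hB, hBy, inner_zero_right] at this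
  exact inner_self_eq_zero.1 this.symm

theorem finiteDimensional_eigenspace_adjoint_comp_self {T : H →L[ℂ] H} (hT : IsCompactOperator T)
    {s : ℝ} (hs : 0 < s) : FiniteDimensional ℂ (Module.End.eigenspace
      ((ContinuousLinearMap.adjoint T ∘L T : H →L[ℂ] H) : H →ₗ[ℂ] H) ((s : ℂ) ^ 2)) :=
  ContinuousLinearMap.finite_dimensional_eigenspace
    (hT.clm_comp (ContinuousLinearMap.adjoint T)) _ (by simpa using hs.ne')

theorem nonempty_schmidtDecomposition {T : H →L[ℂ] H} (hT : IsCompactOperator T) :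
    Nonempty (SchmidtDecomposition T) := by
  set B : H →L[ℂ] H := ContinuousLinearMap.adjoint T ∘L T with hB
  have hBs : (B : H →ₗ[ℂ] H).IsSymmetric := fun x z => by
    change inner ℂ (B x) z = inner ℂ x (B z)
    rw [hB, inner_adjoint_comp_self, inner_adjoint_comp_self_left]
  let E : Set.Ioi (0 : ℝ) → Submodule ℂ H := fun s =>
    Module.End.eigenspace (B : H →ₗ[ℂ] H) (((s : ℝ) : ℂ) ^ 2)
  have hfin : ∀ s, FiniteDimensional ℂ (E s) := fun s =>
    finiteDimensional_eigenspace_adjoint_comp_self hT s.2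
  -- A positive number that is not a singular value has multiplicity zero and contributes no index.
  let ι : Type := Σ s : Set.Ioi (0 : ℝ), Fin (singularValueMultiplicity T s)
  let b : ∀ s : Set.Ioi (0 : ℝ), OrthonormalBasis (Fin (singularValueMultiplicity T s)) ℂ (E s) := fun s =>
    stdOrthonormalBasis ℂ (E s)
  let s : ι → ℝ := fun i => i.1
  let e : ι → H := fun i => b i.1 i.2
  have hpos : ∀ i, 0 < s i := fun i => i.1.2
  have hne : ∀ i, (s i : ℂ) ≠ 0 := fun i => by exact_mod_cast (hpos i).ne'
  have he : Orthonormal ℂ e := by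
    have hinj : Function.Injective fun s : Set.Ioi (0 : ℝ) => ((s : ℝ) : ℂ) ^ 2 := by
      intro x y hxy
      have : (x : ℝ) ^ 2 = (y : ℝ) ^ 2 := by
        simp only at hxy
        exact_mod_cast hxy
      exact Subtype.ext ((pow_left_inj₀ x.2.le y.2.le two_ne_zero).1 this)
    exact (hBs.orthogonalFamily_eigenspaces.comp hinj).orthonormal_sigma_orthonormal
      (fun s => (b s).orthonormal)
  have hBe : ∀ i, B (e i) = ((s i : ℂ) ^ 2) • e i := fun i =>
    Module.End.mem_eigenspace_iff.1 (b i.1 i.2).2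
  let f : ι → H := fun i => (s i : ℂ)⁻¹ • T (e i)
  have hTe : ∀ i, T (e i) = (s i : ℂ) • f i := fun i => by
    simp only [f, smul_smul, mul_inv_cancel₀ (hne i), one_smul]
  have hf : Orthonormal ℂ f := by
    classical
    rw [orthonormal_iff_ite]
    intro i j
    simp only [f]
    rw [inner_smul_left, inner_smul_right, ← inner_adjoint_comp_self, ← hB, hBe, inner_smul_right,
      orthonormal_iff_ite.1 he i j]
    split_ifs with h
    · subst h
      have := hne i
      simp only [map_inv₀, Complex.conj_ofReal]
      field_simp
    · simp
  refine ⟨⟨ι, s, e, f, hpos, he, hf, hTe, fun x => ?_, fun p => ?_⟩⟩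
  · have hsum := summable_inner_smul_of_orthonormal he x
    -- What remains of `x` after projection to the closed span of the `e i` is orthogonal to every
    -- eigenvector for a positive eigenvalue, hence in the kernel of `T`.
    have hy : T (x - ∑' i, inner ℂ (e i) x • e i) = 0 := by
      refine apply_eq_zero_of_inner_eigenspace_eq_zero hT fun r hr v hv => ?_
      have hej : ∀ j, inner ℂ (e j) (x - ∑' i, inner ℂ (e i) x • e i) = 0 := by
        intro j
        have h1 := (hsum.hasSum.mapL (innerSL ℂ (e j))).tsum_eq
        simp only [innerSL_apply_apply] at h1
        rw [inner_sub_right, ← h1, tsum_eq_single j, inner_smul_right,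
          inner_self_eq_norm_sq_to_K, he.1 j]
        · simp
        · intro i hij
          rw [inner_smul_right, he.2 hij.symm, mul_zero]
      have h2 := (b ⟨r, hr⟩).sum_repr ⟨v, hv⟩
      have h3 := congrArg (fun w : E ⟨r, hr⟩ => (w : H)) h2
      simp only [Submodule.coe_sum, Submodule.coe_smul] at h3
      rw [← h3, sum_inner]
      refine Finset.sum_eq_zero fun k _ => ?_
      rw [inner_smul_left, hej ⟨⟨r, hr⟩, k⟩, mul_zero]
    rw [map_sub, sub_eq_zero] at hy
    rw [hy]
    have := hsum.hasSum.mapL T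
    convert! this using 1
    funext i
    rw [map_smul, hTe, mul_comm, mul_smul]
  · rw [schattenENorm, if_pos hT, ENNReal.tsum_sigma']
    congr 1
    refine tsum_congr fun r => ?_
    simp [s]

theorem isCompactOperator_of_memSchatten {p : ℝ} {T : H →L[ℂ] H} (hT : MemSchatten p T) :
    IsCompactOperator T := by
  by_contra h
  rw [MemSchatten, schattenENorm, if_neg h] at hT
  exact lt_irrefl _ hT

/-- A sum over a fixed basis can be compared termwise for different operators, unlike sums over
their singular values. -/
theorem schattenENorm_two_sq {κ : Type*} (b : HilbertBasis κ ℂ H) {T : H →L[ℂ] H}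
    (hT : IsCompactOperator T) : schattenENorm 2 T ^ 2 = ∑' n, ‖T (b n)‖ₑ ^ 2 := by
  obtain ⟨D⟩ := nonempty_schmidtDecomposition hT
  rw [tsum_enorm_sq_eq_of_hasSum b D.orthonormal_e D.orthonormal_f D.hasSum, D.schattenENorm_eq,
    ← ENNReal.rpow_natCast, ← ENNReal.rpow_mul]
  norm_num
  refine tsum_congr fun i => ?_
  rw [← ofReal_norm]
  simp [abs_of_pos (D.pos i)]

/-- The left singular vectors are linearly independent in the range, so there are finitely many
singular values. -/
theorem memSchatten_of_finiteDimensional_range {T : H →L[ℂ] H} {p : ℝ} (hp : 0 ≤ p)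
    (hT : FiniteDimensional ℂ (LinearMap.range (T : H →ₗ[ℂ] H))) : MemSchatten p T := by
  obtain ⟨D⟩ := nonempty_schmidtDecomposition (isCompactOperator_of_finiteDimensional_range hT)
  have hmem : ∀ i, D.f i ∈ LinearMap.range (T : H →ₗ[ℂ] H) := fun i => by
    refine ⟨(D.s i : ℂ)⁻¹ • D.e i, ?_⟩
    have : (D.s i : ℂ) ≠ 0 := by exact_mod_cast (D.pos i).ne'
    rw [map_smul]
    change _ • T (D.e i) = _
    rw [D.apply_e, smul_smul, inv_mul_cancel₀ this, one_smul]
  have hli : LinearIndependent ℂ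
      (fun i => (⟨D.f i, hmem i⟩ : LinearMap.range (T : H →ₗ[ℂ] H))) := by
    refine LinearIndependent.of_comp (Submodule.subtype _) ?_
    exact D.orthonormal_f.linearIndependent
  have : Finite D.ι := hli.finite
  have := Fintype.ofFinite D.ι
  rw [MemSchatten, D.schattenENorm_eq, tsum_fintype]
  refine ENNReal.rpow_lt_top_of_nonneg (by positivity) (ENNReal.sum_lt_top.2 fun i _ => ?_).ne
  exact ENNReal.rpow_lt_top_of_nonneg hp ENNReal.ofReal_ne_top

/-- Frees the trace from its chosen basis: by Cauchy–Schwarz the double series over `k` and the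
basis converges absolutely, so the sums can be exchanged and Parseval applied for each `k`. -/
theorem trace_eq_tsum_inner {κ : Type*} {g h : κ → H} (hgh : Summable fun k => ‖g k‖ * ‖h k‖)
    {R : H →L[ℂ] H} (hR : ∀ x, HasSum (fun k => inner ℂ (h k) x • g k) (R x)) :
    trace R = ∑' k, inner ℂ (h k) (g k) := by
  rw [trace]
  generalize (exists_hilbertBasis ℂ H).choose_spec.choose = b
  have h1 : ∀ n, inner ℂ (b n) (R (b n)) = ∑' k, inner ℂ (h k) (b n) * inner ℂ (b n) (g k) := by
    intro n
    have := ((hR (b n)).mapL (innerSL ℂ (b n))).tsum_eq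
    simp only [innerSL_apply_apply, inner_smul_right] at this
    exact this.symm
  have hk : ∀ k, (Summable fun n => ‖inner ℂ (h k) (b n) * inner ℂ (b n) (g k)‖) ∧
      ∑' n, ‖inner ℂ (h k) (b n) * inner ℂ (b n) (g k)‖ ≤ ‖g k‖ * ‖h k‖ := by
    intro k
    have h2 := lp.tsum_mul_le_mul_norm (p := 2) (q := 2)
      (by simpa using Real.HolderConjugate.two_two) (b.repr (h k)) (b.repr (g k))
    simp only [b.repr_apply_apply, LinearIsometryEquiv.norm_map] at h2
    simpa only [norm_mul, norm_inner_symm (h k), mul_comm ‖g k‖] using h2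
  have hs : Summable (Function.uncurry
      fun k n => inner ℂ (h k) (b n) * inner ℂ (b n) (g k)) := by
    refine Summable.of_norm ((summable_prod_of_nonneg fun _ => norm_nonneg _).2
      ⟨fun k => (hk k).1, ?_⟩)
    exact hgh.of_nonneg_of_le (fun k => tsum_nonneg fun _ => norm_nonneg _) fun k => (hk k).2
  simp_rw [h1]
  refine hs.tsum_comm.trans ?_
  exact tsum_congr fun k => b.tsum_inner_mul_inner (h k) (g k)

end Schmidt

/-! ### Three lines interpolation of a finite bilinear form. -/

section Interpolation

/-- Interpolation of a bilinear form between `ℓ¹ × ℓ¹` and `ℓ² × ℓ²`. -/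
theorem norm_sum_le_of_bilinear_bounds {ι J : Type*} [Fintype ι] [Fintype J] {p q : ℝ}
    (hpq : p.HolderConjugate q) (hp2 : p ≤ 2) {s : ι → ℝ} (hs : ∀ i, 0 < s i) {c : J → ℝ}
    (hc : ∀ j, 0 < c j) {m : J → ℝ} {M : ι → J → ℂ}
    (h1 : ∀ (a : ι → ℂ) (b : J → ℂ),
      ‖∑ i, ∑ j, a i * b j * M i j‖ ≤ (∑ i, ‖a i‖) * ∑ j, ‖b j‖ * m j)
    (h2 : ∀ (a : ι → ℂ) (b : J → ℂ),
      ‖∑ i, ∑ j, a i * b j * M i j‖ ≤ √(∑ i, ‖a i‖ ^ 2) * √(∑ j, ‖b j‖ ^ 2 * m j))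
    (hm : ∀ j, 0 ≤ m j) :
    ‖∑ i, ∑ j, (s i : ℂ) * ((c j ^ (q - 1) : ℝ) : ℂ) * M i j‖
      ≤ (∑ i, s i ^ p) ^ (1 / p) * (∑ j, c j ^ q * m j) ^ (1 / p) := by
  have hp0 : 0 < p := hpq.pos
  have hq0 : 0 < q := hpq.symm.pos
  set A := ∑ i, s i ^ p
  set R := ∑ j, c j ^ q * m j
  have hA : 0 ≤ A := Finset.sum_nonneg fun i _ => Real.rpow_nonneg (hs i).le _
  have hR : 0 ≤ R := Finset.sum_nonneg fun j _ =>
    mul_nonneg (Real.rpow_nonneg (hc j).le _) (hm j)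
  -- The coefficients have moduli `s i ^ p` and `c j ^ q` on `re w = 0`, and the square roots of
  -- these on `re w = 1`. At `w = 2 / q` the exponents are `1` and `q - 1`, which is the sum to be
  -- estimated.
  let F : ℂ → ℂ := fun w => ∑ i, ∑ j,
    (s i : ℂ) ^ (p * (1 - w / 2) : ℂ) * (c j : ℂ) ^ (q * (1 - w / 2) : ℂ) * M i j
  have hns : ∀ i (w : ℂ), ‖(s i : ℂ) ^ (p * (1 - w / 2) : ℂ)‖ = s i ^ (p * (1 - w.re / 2)) := by
    intro i w
    rw [Complex.norm_cpow_eq_rpow_re_of_pos (hs i)]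
    simp
  have hnc : ∀ j (w : ℂ), ‖(c j : ℂ) ^ (q * (1 - w / 2) : ℂ)‖ = c j ^ (q * (1 - w.re / 2)) := by
    intro j w
    rw [Complex.norm_cpow_eq_rpow_re_of_pos (hc j)]
    simp
  have hF : Differentiable ℂ F := by
    refine Differentiable.fun_sum fun i _ => Differentiable.fun_sum fun j _ => ?_
    have hsi : (s i : ℂ) ≠ 0 := by exact_mod_cast (hs i).ne'
    have hcj : (c j : ℂ) ≠ 0 := by exact_mod_cast (hc j).ne'
    refine Differentiable.mul_const (Differentiable.mul ?_ ?_) _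
    · exact Differentiable.const_cpow (by fun_prop) (Or.inl hsi)
    · exact Differentiable.const_cpow (by fun_prop) (Or.inl hcj)
  -- The norm is dominated by a continuous function of `w.re` alone, which is bounded on `[0, 1]`.
  have hB : BddAbove ((norm ∘ F) '' Complex.HadamardThreeLines.verticalClosedStrip 0 1) := by
    let h : ℝ → ℝ := fun t => ∑ i, ∑ j,
      s i ^ (p * (1 - t / 2)) * c j ^ (q * (1 - t / 2)) * ‖M i j‖
    have hcont : Continuous h := by
      refine continuous_finsetSum _ fun i _ => continuous_finsetSum _ fun j _ => ?_
      refine Continuous.mul (Continuous.mul ?_ ?_) continuous_const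
      · exact Continuous.rpow continuous_const (by fun_prop) fun _ => Or.inl (hs i).ne'
      · exact Continuous.rpow continuous_const (by fun_prop) fun _ => Or.inl (hc j).ne'
    obtain ⟨K, hK⟩ := (isCompact_Icc (a := (0 : ℝ)) (b := 1)).bddAbove_image hcont.continuousOn
    refine ⟨K, ?_⟩
    rintro _ ⟨w, hw, rfl⟩
    refine le_trans ?_ (hK ⟨w.re, hw, rfl⟩)
    refine (norm_sum_le _ _).trans (Finset.sum_le_sum fun i _ =>
      (norm_sum_le _ _).trans (Finset.sum_le_sum fun j _ => ?_))
    rw [norm_mul, norm_mul, hns, hnc]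
  have hθ0 : 0 ≤ 2 / q := by positivity
  have hq2 : 2 ≤ q := by
    have := hpq.symm.inv_add_inv_eq_one
    have h3 : (2 : ℝ)⁻¹ ≤ p⁻¹ := inv_anti₀ hp0 hp2
    have h4 : q⁻¹ ≤ (2 : ℝ)⁻¹ := by norm_num at h3 ⊢; linarith
    exact (inv_le_inv₀ hq0 two_pos).1 h4
  have hθ1 : 2 / q ≤ 1 := (div_le_one hq0).2 hq2
  have key := Complex.HadamardThreeLines.norm_le_interp_of_mem_verticalClosedStrip'
    (f := F) (z := ((2 / q : ℝ) : ℂ)) (a := A * R) (b := √A * √R) (l := 0) (u := 1) one_pos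
    (by
      change ((2 / q : ℝ) : ℂ).re ∈ Set.Icc (0 : ℝ) 1
      rw [Complex.ofReal_re]
      exact ⟨hθ0, hθ1⟩) hF.diffContOnCl hB
    (by
      intro w hw
      have hw' : w.re = 0 := hw
      refine (h1 _ _).trans_eq ?_
      simp only [hns, hnc, hw']
      simp [A, R])
    (by
      intro w hw
      have hw' : w.re = 1 := hw
      refine (h2 _ _).trans_eq ?_
      simp only [hns, hnc, hw']
      have e1 : ∀ x t : ℝ, 0 < x → (x ^ (t * (1 - 1 / 2) : ℝ)) ^ 2 = x ^ t := by
        intro x t hx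
        rw [← Real.rpow_natCast, ← Real.rpow_mul hx.le]
        congr 1
        push_cast
        ring
      simp only [e1 _ _ (hs _), e1 _ _ (hc _), A, R])
  have hval : F ((2 / q : ℝ) : ℂ) = ∑ i, ∑ j, (s i : ℂ) * ((c j ^ (q - 1) : ℝ) : ℂ) * M i j := by
    have e1 : (p * (1 - ((2 / q : ℝ) : ℂ) / 2) : ℂ) = ((1 : ℝ) : ℂ) := by
      have : p * (1 - (2 / q) / 2) = 1 := by
        have h5 : 1 - 2 / q / 2 = p⁻¹ := by
          have := hpq.inv_add_inv_eq_one
          rw [div_right_comm]; norm_num; linarith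
        rw [h5, mul_inv_cancel₀ hp0.ne']
      exact_mod_cast this
    have e2 : (q * (1 - ((2 / q : ℝ) : ℂ) / 2) : ℂ) = ((q - 1 : ℝ) : ℂ) := by
      have : q * (1 - (2 / q) / 2) = q - 1 := by field_simp
      exact_mod_cast this
    refine Finset.sum_congr rfl fun i _ => Finset.sum_congr rfl fun j _ => ?_
    rw [e1, e2, ← Complex.ofReal_cpow (hs i).le, ← Complex.ofReal_cpow (hc j).le, Real.rpow_one]
  rw [hval] at key
  refine key.trans_eq ?_
  -- Interpolating the boundary bounds `A * R` and `√A * √R` gives exponent `1 - 2 / q + 1 / q = 1 /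
  -- p` on both factors.
  have e3 : ∀ x : ℝ, 0 ≤ x → x ^ (1 - 2 / q) * √x ^ (2 / q) = x ^ (1 / p) := by
    intro x hx
    have h5 : 1 - 2 / q + 1 / 2 * (2 / q) = 1 / p := by
      have := hpq.inv_add_inv_eq_one
      rw [one_div p]
      have h6 : 1 / 2 * (2 / q) = q⁻¹ := by field_simp
      have h7 : 2 / q = 2 * q⁻¹ := by field_simp
      rw [h6, h7]; linarith
    rw [Real.sqrt_eq_rpow, ← Real.rpow_mul hx, ← h5, Real.rpow_add_of_nonneg hx (by linarith)
      (by positivity)]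
  rw [Complex.ofReal_re, sub_zero, sub_zero, div_one, Real.mul_rpow hA hR,
    Real.mul_rpow (Real.sqrt_nonneg _) (Real.sqrt_nonneg _), ← e3 A hA, ← e3 R hR]
  ring

end Interpolation

/-! ### F. Riesz's inequality, on level sets and then for integrals. -/

section Riesz

variable {α : Type*} [MeasurableSpace α] {μ : Measure α}

theorem setIntegral_norm_le_sqrt_mul_sqrt {g : α → ℂ} (hg : AEStronglyMeasurable g μ)
    (hg2 : Integrable (fun z => ‖g z‖ ^ 2) μ) {E : Set α} (hE : μ E < ∞) :
    ∫ z in E, ‖g z‖ ∂μ ≤ √(μ.real E) * √(∫ z in E, ‖g z‖ ^ 2 ∂μ) := by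
  have : IsFiniteMeasure (μ.restrict E) := ⟨by simpa using hE⟩
  have hm : MemLp g 2 μ := (memLp_two_iff_integrable_sq_norm hg).2 hg2
  have h := integral_mul_le_Lp_mul_Lq_of_nonneg (μ := μ.restrict E) Real.HolderConjugate.two_two
    (f := fun _ => (1 : ℝ)) (g := fun z => ‖g z‖) (Eventually.of_forall fun _ => zero_le_one)
    (Eventually.of_forall fun _ => norm_nonneg _) (memLp_const 1)
    (by simpa using hm.restrict E |>.norm)
  simpa [Real.sqrt_eq_rpow] using h

/-- The discrete form of F. Riesz's inequality for uniformly bounded orthonormal systems. -/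
theorem sum_rpow_mul_measureReal_le {ι J : Type*} [Fintype ι] [Fintype J] {p q : ℝ}
    (hpq : p.HolderConjugate q) (hp2 : p ≤ 2) {φ : ι → α → ℂ}
    (hφ : ∀ i, AEStronglyMeasurable (φ i) μ) (hb : ∀ i z, ‖φ i z‖ ≤ 1)
    (h2 : ∀ a : ι → ℂ, Integrable (fun z => ‖∑ i, a i * φ i z‖ ^ 2) μ ∧
      ∫ z, ‖∑ i, a i * φ i z‖ ^ 2 ∂μ ≤ ∑ i, ‖a i‖ ^ 2)
    {s : ι → ℝ} (hs : ∀ i, 0 < s i) {c : J → ℝ} (hc : ∀ j, 0 < c j) {E : J → Set α}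
    (hE : ∀ j, MeasurableSet (E j)) (hEd : Pairwise (Function.onFun Disjoint E))
    (hEf : ∀ j, μ (E j) < ∞) (hcE : ∀ j, ∀ z ∈ E j, c j ≤ ‖∑ i, (s i : ℂ) * φ i z‖) :
    ∑ j, c j ^ q * μ.real (E j) ≤ (∑ i, s i ^ p) ^ (q / p) := by
  have hp0 : 0 < p := hpq.pos
  have hq0 : 0 < q := hpq.symm.pos
  set G : α → ℂ := fun z => ∑ i, (s i : ℂ) * φ i z with hG
  have hsum : ∀ a : ι → ℂ, AEStronglyMeasurable (fun z => ∑ i, a i * φ i z) μ := fun a =>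
    Finset.aestronglyMeasurable_fun_sum _ fun i _ => (hφ i).const_mul (a i)
  -- The conjugate phase of `G`; where `G` vanishes, division by zero makes it zero.
  let σ : α → ℂ := fun z => star (G z) / ‖G z‖
  have hσ : AEStronglyMeasurable σ μ := by
    have h1 : AEMeasurable G μ := (hsum _).aemeasurable
    have h3 : AEMeasurable (fun z => star (G z)) μ := continuous_star.measurable.comp_aemeasurable h1
    exact (h3.div (Complex.measurable_ofReal.comp_aemeasurable h1.norm)).aestronglyMeasurable
  have hσ1 : ∀ z, ‖σ z‖ ≤ 1 := fun z => by
    simp only [σ, norm_div, norm_star, Complex.norm_real, norm_norm]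
    exact div_self_le_one _
  have hGσ : ∀ z, G z * σ z = (‖G z‖ : ℂ) := fun z => by
    by_cases h0 : G z = 0
    · simp [h0]
    · have : (‖G z‖ : ℂ) ≠ 0 := by simpa using h0
      simp only [σ]
      rw [mul_div_assoc', div_eq_iff this, RCLike.star_def, Complex.mul_conj, Complex.normSq_eq_norm_sq]
      push_cast
      ring
  have hint : ∀ i j, IntegrableOn (fun z => φ i z * σ z) (E j) μ := fun i j =>
    Measure.integrableOn_of_bounded (M := 1) (hEf j).ne ((hφ i).mul hσ)
      (Eventually.of_forall fun z => by
        rw [norm_mul]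
        exact mul_le_one₀ (hb i z) (norm_nonneg _) (hσ1 z))
  let M : ι → J → ℂ := fun i j => ∫ z in E j, φ i z * σ z ∂μ
  have hM : ∀ (a : ι → ℂ) j, ∑ i, a i * M i j = ∫ z in E j, (∑ i, a i * φ i z) * σ z ∂μ := by
    intro a j
    simp only [M, ← integral_const_mul]
    rw [← integral_finsetSum _ fun i _ => (hint i j).const_mul (a i)]
    refine integral_congr_ae (Eventually.of_forall fun z => ?_)
    simp only [Finset.sum_mul, mul_assoc]
  have hM' : ∀ (a : ι → ℂ) (b : J → ℂ), ∑ i, ∑ j, a i * b j * M i j =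
      ∑ j, b j * ∫ z in E j, (∑ i, a i * φ i z) * σ z ∂μ := by
    intro a b
    rw [Finset.sum_comm]
    refine Finset.sum_congr rfl fun j _ => ?_
    rw [← hM, Finset.mul_sum]
    exact Finset.sum_congr rfl fun i _ => by ring
  -- The first bound is `‖M i j‖ ≤ μ (E j)`, from `‖φ i‖ ≤ 1`. The second is Cauchy–Schwarz on each
  -- `E j` and then over `j`, with disjointness of the `E j` and the `L²` bound `h2`.
  have key := norm_sum_le_of_bilinear_bounds hpq hp2 hs hc (m := fun j => μ.real (E j)) (M := M)
    (by
      intro a b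
      refine (norm_sum_le _ _).trans ?_
      rw [Finset.sum_mul_sum]
      refine Finset.sum_le_sum fun i _ => (norm_sum_le _ _).trans (Finset.sum_le_sum fun j _ => ?_)
      rw [norm_mul, norm_mul, mul_assoc]
      gcongr
      have := norm_setIntegral_le_of_norm_le_const (μ := μ) (f := fun z => φ i z * σ z) (C := 1)
        (hEf j) (fun z _ => by
          rw [norm_mul]
          exact mul_le_one₀ (hb i z) (norm_nonneg _) (hσ1 z))
      simpa using this)
    (by
      intro a b
      rw [hM']
      obtain ⟨hi, hle⟩ := h2 a
      set g : α → ℂ := fun z => ∑ i, a i * φ i z with hg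
      have h3 : ∀ j, ‖b j * ∫ z in E j, g z * σ z ∂μ‖ ≤
          (‖b j‖ * √(μ.real (E j))) * √(∫ z in E j, ‖g z‖ ^ 2 ∂μ) := by
        intro j
        rw [norm_mul, mul_assoc]
        gcongr
        refine (norm_integral_le_integral_norm _).trans
          (le_trans ?_ (setIntegral_norm_le_sqrt_mul_sqrt (hsum a) hi (hEf j)))
        have : IsFiniteMeasure (μ.restrict (E j)) := ⟨by simpa using hEf j⟩
        have hgi : IntegrableOn (fun z => ‖g z‖) (E j) μ :=
          ((((memLp_two_iff_integrable_sq_norm (hsum a)).2 hi).restrict (E j)).integrable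
            one_le_two).norm
        refine integral_mono_of_nonneg (Eventually.of_forall fun _ => norm_nonneg _) hgi
          (Eventually.of_forall fun z => ?_)
        simp only [norm_mul]
        exact mul_le_of_le_one_right (norm_nonneg _) (hσ1 z)
      refine (norm_sum_le _ _).trans ((Finset.sum_le_sum fun j _ => h3 j).trans ?_)
      have h4 := Real.sum_mul_le_sqrt_mul_sqrt Finset.univ (fun j => ‖b j‖ * √(μ.real (E j)))
        (fun j => √(∫ z in E j, ‖g z‖ ^ 2 ∂μ))
      refine h4.trans ?_
      have h5 : ∀ j, √(∫ z in E j, ‖g z‖ ^ 2 ∂μ) ^ 2 = ∫ z in E j, ‖g z‖ ^ 2 ∂μ := fun j =>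
        Real.sq_sqrt (integral_nonneg fun _ => by positivity)
      have h6 : ∀ j, (‖b j‖ * √(μ.real (E j))) ^ 2 = ‖b j‖ ^ 2 * μ.real (E j) := fun j => by
        rw [mul_pow, Real.sq_sqrt measureReal_nonneg]
      simp only [h5, h6]
      rw [mul_comm]
      gcongr
      rw [← integral_iUnion_fintype hE hEd fun j => hi.integrableOn]
      exact (setIntegral_le_integral hi (Eventually.of_forall fun _ => by positivity)).trans hle)
    (fun j => measureReal_nonneg)
  set R := ∑ j, c j ^ q * μ.real (E j)
  set A := ∑ i, s i ^ p
  have hA : 0 ≤ A := Finset.sum_nonneg fun i _ => Real.rpow_nonneg (hs i).le _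
  have hR : 0 ≤ R := Finset.sum_nonneg fun j _ =>
    mul_nonneg (Real.rpow_nonneg (hc j).le _) measureReal_nonneg
  -- The phase `σ` turns the form into `∑ c j ^ (q - 1) ∫ ‖G‖` over the `E j`, and `‖G‖ ≥ c j`
  -- there.
  have hlow : R ≤ ‖∑ i, ∑ j, (s i : ℂ) * ((c j ^ (q - 1) : ℝ) : ℂ) * M i j‖ := by
    rw [hM']
    have h7 : ∀ j, ∫ z in E j, (∑ i, (s i : ℂ) * φ i z) * σ z ∂μ =
        ((∫ z in E j, ‖G z‖ ∂μ : ℝ) : ℂ) := fun j => by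
      rw [← integral_complex_ofReal]
      exact integral_congr_ae (Eventually.of_forall fun z => hGσ z)
    simp only [h7]
    have h8 : ∑ j, ((c j ^ (q - 1) : ℝ) : ℂ) * ((∫ z in E j, ‖G z‖ ∂μ : ℝ) : ℂ) =
        ((∑ j, c j ^ (q - 1) * ∫ z in E j, ‖G z‖ ∂μ : ℝ) : ℂ) := by push_cast; rfl
    rw [h8, Complex.norm_real]
    refine le_trans ?_ (Real.le_norm_self _)
    refine Finset.sum_le_sum fun j _ => ?_
    have h9 : c j * μ.real (E j) ≤ ∫ z in E j, ‖G z‖ ∂μ := by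
      have : IsFiniteMeasure (μ.restrict (E j)) := ⟨by simpa using hEf j⟩
      have hgi : IntegrableOn (fun z => ‖G z‖) (E j) μ :=
        ((((memLp_two_iff_integrable_sq_norm (hsum fun i => (s i : ℂ))).2
          (h2 fun i => (s i : ℂ)).1).restrict (E j)).integrable one_le_two).norm
      have := setIntegral_ge_of_const_le_real (hE j) (hEf j).ne (hcE j) hgi
      exact this
    calc c j ^ q * μ.real (E j) = c j ^ (q - 1) * (c j * μ.real (E j)) := by
          rw [← mul_assoc, ← Real.rpow_add_one (hc j).ne', sub_add_cancel]
      _ ≤ _ := by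
          have := (hc j).le
          gcongr
  have hfin := hlow.trans key
  rcases hR.eq_or_lt with h0 | hpos
  · rw [← h0]; exact Real.rpow_nonneg hA _
  -- The bound so far is `R ≤ A ^ (1 / p) * R ^ (1 / p)`; a positive real `R` can be cancelled.
  · have h10 : R ^ (1 / q) ≤ A ^ (1 / p) := by
      have hsplit : R = R ^ (1 / q) * R ^ (1 / p) := by
        rw [← Real.rpow_add hpos, one_div, one_div, hpq.symm.inv_add_inv_eq_one, Real.rpow_one]
      have hRp : 0 < R ^ (1 / p) := Real.rpow_pos_of_pos hpos _
      refine le_of_mul_le_mul_right ?_ hRp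
      rw [← hsplit]; exact hfin
    have h11 := Real.rpow_le_rpow (by positivity) h10 hq0.le
    rw [← Real.rpow_mul hR, ← Real.rpow_mul hA, one_div_mul_cancel hq0.ne', Real.rpow_one,
      one_div_mul_eq_div] at h11
    exact h11

/-- **F. Riesz's inequality**: the Hausdorff-Young inequality for uniformly bounded orthonormal
systems. -/
theorem lintegral_enorm_sum_rpow_le {ι : Type*} [Fintype ι] {p q : ℝ}
    (hpq : p.HolderConjugate q) (hp2 : p ≤ 2) {φ : ι → α → ℂ}
    (hφ : ∀ i, AEStronglyMeasurable (φ i) μ) (hb : ∀ i z, ‖φ i z‖ ≤ 1)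
    (h2 : ∀ a : ι → ℂ, Integrable (fun z => ‖∑ i, a i * φ i z‖ ^ 2) μ ∧
      ∫ z, ‖∑ i, a i * φ i z‖ ^ 2 ∂μ ≤ ∑ i, ‖a i‖ ^ 2)
    {s : ι → ℝ} (hs : ∀ i, 0 < s i) :
    ∫⁻ z, ‖∑ i, (s i : ℂ) * φ i z‖ₑ ^ q ∂μ ≤ ENNReal.ofReal ((∑ i, s i ^ p) ^ (q / p)) := by
  have hq0 : 0 < q := hpq.symm.pos
  set G : α → ℂ := fun z => ∑ i, (s i : ℂ) * φ i z with hG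
  rw [lintegral_eq_nnreal]
  refine iSup₂_le fun ψ hψ => ?_
  rw [SimpleFunc.map_lintegral]
  let J : Type := {x // x ∈ ψ.range.erase 0}
  -- The simple function `ψ` lies below `‖G‖ ^ q`, so on the level set of `x` the lower bound for
  -- `‖G‖` is the `q`-th root of `x`.
  let c : J → ℝ := fun x => (x.1 : ℝ) ^ (1 / q)
  let E : J → Set α := fun x => ψ ⁻¹' {x.1}
  have hpos : ∀ x : J, 0 < (x.1 : ℝ) := fun x => by
    have := (Finset.mem_erase.1 x.2).1
    exact_mod_cast pos_iff_ne_zero.2 this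
  have hc : ∀ x, 0 < c x := fun x => Real.rpow_pos_of_pos (hpos x) _
  have hE : ∀ x, MeasurableSet (E x) := fun x => ψ.measurableSet_fiber _
  have hEd : Pairwise (Function.onFun Disjoint E) := fun x y hxy =>
    Disjoint.preimage _ (Set.disjoint_singleton.2 fun h => hxy (Subtype.ext h))
  have hcE : ∀ x, ∀ z ∈ E x, c x ≤ ‖G z‖ := by
    intro x z hz
    have hz' : ψ z = x.1 := hz
    have h3 := hψ z
    rw [hz', ← ofReal_norm, ENNReal.ofReal_rpow_of_nonneg (norm_nonneg _) hq0.le,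
      ← ENNReal.ofReal_coe_nnreal, ENNReal.ofReal_le_ofReal_iff (by positivity)] at h3
    have h4 := Real.rpow_le_rpow (hpos x).le h3 (one_div_nonneg.2 hq0.le)
    rwa [← Real.rpow_mul (norm_nonneg _), mul_one_div_cancel hq0.ne', Real.rpow_one] at h4
  -- Chebyshev's inequality for the integrable function `‖G‖ ^ 2`.
  have hEf : ∀ x, μ (E x) < ∞ := by
    intro x
    have hi := (h2 fun i => (s i : ℂ)).1
    refine (measure_mono fun z hz => ?_).trans_lt
      (hi.measure_norm_ge_lt_top (ε := c x ^ 2) (by have := hc x; positivity))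
    change c x ^ 2 ≤ ‖‖G z‖ ^ 2‖
    rw [Real.norm_of_nonneg (by positivity)]
    have := hcE x z hz
    have := (hc x).le
    gcongr
  have key := sum_rpow_mul_measureReal_le hpq hp2 hφ hb h2 hs hc hE hEd hEf hcE
  refine le_trans (le_of_eq ?_) (ENNReal.ofReal_le_ofReal key)
  have h5 : ∀ x : J, c x ^ q = x.1 := fun x => by
    rw [← Real.rpow_mul (hpos x).le, one_div_mul_cancel hq0.ne', Real.rpow_one]
  simp only [h5]
  rw [ENNReal.ofReal_sum_of_nonneg fun x _ => mul_nonneg (hpos x).le measureReal_nonneg]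
  have h6 : ∀ x : J, ENNReal.ofReal ((x.1 : ℝ) * μ.real (E x)) = (x.1 : ℝ≥0∞) * μ (E x) := by
    intro x
    rw [ENNReal.ofReal_mul (hpos x).le, ENNReal.ofReal_coe_nnreal, measureReal_def,
      ENNReal.ofReal_toReal (hEf x).ne]
  simp only [h6]
  rw [← Finset.sum_erase ψ.range (a := 0) (by simp)]
  exact (Finset.sum_coe_sort (ψ.range.erase 0) fun x => (x : ℝ≥0∞) * μ (ψ ⁻¹' {x})).symm

end Riesz

/-! ### From a norm identity to an inner product identity. -/

section Polarization

variable {H K : Type*} [NormedAddCommGroup H] [InnerProductSpace ℂ H] [NormedAddCommGroup K]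
  [InnerProductSpace ℂ K]

/-- A sesquilinear map with `‖U g h‖ = ‖g‖ ‖h‖` preserves the Hilbert-Schmidt inner products of
rank one operators. -/
theorem inner_eq_of_norm_eq_mul {U : H → H → K} (hU : ∀ g h, ‖U g h‖ = ‖g‖ * ‖h‖)
    (hadd : ∀ g g' h, U (g + g') h = U g h + U g' h) (hsmul : ∀ (c : ℂ) g h, U (c • g) h = c • U g h)
    (hadd' : ∀ g h h', U g (h + h') = U g h + U g h')
    (hsmul' : ∀ (c : ℂ) g h, U g (c • h) = star c • U g h) (g g' h h' : H) :
    inner ℂ (U g h) (U g' h') = inner ℂ g g' * inner ℂ h' h := by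
  have hsub : ∀ g g' h, U (g - g') h = U g h - U g' h := fun g g' h => by
    rw [sub_eq_add_neg, hadd, ← neg_one_smul ℂ g', hsmul, neg_one_smul, ← sub_eq_add_neg]
  have hdiag : ∀ h, inner ℂ (U g h) (U g' h) = inner ℂ g g' * inner ℂ h h := by
    intro h
    rw [inner_eq_sum_norm_sq_div_four (𝕜 := ℂ) (U g h), inner_eq_sum_norm_sq_div_four g g',
      inner_self_eq_norm_sq_to_K, ← hadd, ← hsub, ← hsmul, ← hsub, ← hadd, hU, hU, hU, hU]
    simp only [RCLike.I_to_complex, Complex.coe_algebraMap, Complex.ofReal_mul]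
    ring
  -- Polarization in `g` alone gives the identity for equal second arguments. The defect `B` is thus
  -- a sesquilinear form vanishing on the diagonal; testing it with `h'` and `I • h'` shows that it
  -- is zero.
  let B : H → H → ℂ := fun h h' => inner ℂ (U g h) (U g' h') - inner ℂ g g' * inner ℂ h' h
  have hB0 : ∀ h, B h h = 0 := fun h => sub_eq_zero.2 (hdiag h)
  have hBa : ∀ h₁ h₂ h', B (h₁ + h₂) h' = B h₁ h' + B h₂ h' := fun h₁ h₂ h' => by
    simp only [B, hadd', inner_add_left, inner_add_right]; ring
  have hBa' : ∀ h h₁ h₂, B h (h₁ + h₂) = B h h₁ + B h h₂ := fun h h₁ h₂ => by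
    simp only [B, hadd', inner_add_left, inner_add_right]; ring
  have hBs : ∀ (c : ℂ) h h', B (c • h) h' = c * B h h' := fun c h h' => by
    simp only [B, hsmul', inner_smul_left, inner_smul_right, RCLike.star_def,
      RingHomCompTriple.comp_apply, RingHom.id_apply]
    ring
  have hBs' : ∀ (c : ℂ) h h', B h (c • h') = star c * B h h' := fun c h h' => by
    simp only [B, hsmul', inner_smul_left, inner_smul_right, RCLike.star_def]; ring
  have h1 : ∀ x y, B x y + B y x = 0 := fun x y => by
    have := hB0 (x + y)
    rwa [hBa, hBa', hBa', hB0, hB0, zero_add, add_zero] at this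
  have h2 := h1 h h'
  have h3 := h1 h (Complex.I • h')
  rw [hBs, hBs', RCLike.star_def, Complex.conj_I] at h3
  have h4 : B h h' = 0 := by
    have h5 : Complex.I * (B h' h - B h h') = 0 := by linear_combination h3
    have h6 := (mul_eq_zero.1 h5).resolve_left Complex.I_ne_zero
    linear_combination (1 / 2 : ℂ) * h2 - (1 / 2 : ℂ) * h6
  exact sub_eq_zero.1 h4

end Polarization

/-! ### Plancherel's theorem for the Fourier integral on `L¹ ∩ L²`. -/

section Plancherel

open FourierTransform SchwartzMap

variable {V : Type*} [NormedAddCommGroup V] [InnerProductSpace ℝ V] [FiniteDimensional ℝ V]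
  [MeasurableSpace V] [BorelSpace V]

theorem continuous_fourier_of_integrable {u : V → ℂ} (hu : Integrable u) : Continuous (𝓕 u) :=
  VectorFourier.fourierIntegral_continuous (L := innerₗ V) Real.continuous_fourierChar
    continuous_inner hu

/-- On `L¹ ∩ L²` the Fourier transform of `L²` is given by the Fourier integral. -/
theorem coeFn_fourier_toLp_ae_eq {u : V → ℂ} (hu : Integrable u) (hu2 : MemLp u 2) :
    ((𝓕 (hu2.toLp u) : Lp ℂ 2 (volume : Measure V)) : V → ℂ) =ᵐ[volume] 𝓕 u := by
  -- Testing against smooth compactly supported `g` moves both transforms onto a Schwartz function: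
  -- the `L²` one through tempered distributions, the integral one by Fubini.
  refine ae_eq_of_integral_contDiff_smul_eq (μ := volume) ((Lp.memLp _).locallyIntegrable one_le_two)
    (continuous_fourier_of_integrable hu).locallyIntegrable fun g hg hgs => ?_
  have hg₁ : HasCompactSupport (Complex.ofRealCLM ∘ g) := hgs.comp_left rfl
  have hg₂ : ContDiff ℝ ((⊤ : ℕ∞) : WithTop ℕ∞) (Complex.ofRealCLM ∘ g) :=
    Complex.ofRealCLM.contDiff.comp hg
  set G : 𝓢(V, ℂ) := hg₁.toSchwartzMap hg₂ with hG
  have hGv : ∀ x, G x = (g x : ℂ) := fun x => by simp [hG]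
  calc ∫ x, g x • (𝓕 (hu2.toLp u) : Lp ℂ 2 (volume : Measure V)) x
      = Lp.toTemperedDistributionCLM ℂ volume 2 (𝓕 (hu2.toLp u)) G := by
        rw [Lp.toTemperedDistributionCLM_apply, Lp.toTemperedDistribution_apply]
        simp [hGv]
    _ = Lp.toTemperedDistributionCLM ℂ volume 2 (hu2.toLp u) (𝓕 G) := by
        rw [Lp.toTemperedDistributionCLM_apply, Lp.toTemperedDistributionCLM_apply,
          ← Lp.fourier_toTemperedDistribution_eq, TemperedDistribution.fourier_apply]
    _ = ∫ x, (𝓕 G) x • u x := by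
        rw [Lp.toTemperedDistributionCLM_apply, Lp.toTemperedDistribution_apply]
        refine integral_congr_ae ?_
        filter_upwards [hu2.coeFn_toLp] with x hx
        rw [hx]
    _ = ∫ x, G x • (𝓕 u) x := by
        rw [SchwartzMap.fourier_coe]
        exact VectorFourier.integral_fourierIntegral_smul_eq_flip (L := innerₗ V)
          Real.continuous_fourierChar continuous_inner G.integrable hu |>.trans (by rw [flip_innerₗ]; rfl)
    _ = ∫ x, g x • 𝓕 u x := integral_congr_ae (Eventually.of_forall fun x => by simp [hGv])

/-- **Plancherel's theorem** for the Fourier integral. -/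
theorem lintegral_enorm_fourier_sq {u : V → ℂ} (hu : Integrable u) (hu2 : MemLp u 2) :
    ∫⁻ ω, ‖𝓕 u ω‖ₑ ^ 2 = ∫⁻ t, ‖u t‖ₑ ^ 2 := by
  have h1 := congrArg (fun r : ℝ => ENNReal.ofReal r) (Lp.norm_fourier_eq (hu2.toLp u))
  simp only [ofReal_norm, Lp.enorm_def] at h1
  rw [eLpNorm_congr_ae (coeFn_fourier_toLp_ae_eq hu hu2), eLpNorm_congr_ae hu2.coeFn_toLp] at h1
  simp only [eLpNorm_eq_lintegral_rpow_enorm_toReal two_ne_zero ENNReal.ofNat_ne_top,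
    ENNReal.toReal_ofNat, ENNReal.rpow_ofNat] at h1
  exact ENNReal.rpow_left_injective (by norm_num) h1

end Plancherel

/-! ### Ambiguity functions and Moyal's identity. -/

section Ambiguity

open FourierTransform

variable {d : ℕ}

theorem timeFreqShift_ae_eq (z : Phase d) (ψ : L2 d) :
    timeFreqShift z ψ =ᵐ[volume] shiftFun z ψ :=
  (memLp_shiftFun z ψ).coeFn_toLp

theorem norm_timeFreqShift_apply (z : Phase d) (ψ : L2 d) : ‖timeFreqShift z ψ‖ = ‖ψ‖ := by
  rw [Lp.norm_def, Lp.norm_def, eLpNorm_congr_ae (timeFreqShift_ae_eq z ψ),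
    eLpNorm_shiftFun z (Lp.aestronglyMeasurable ψ)]

/-- The Fourier-Wigner transform of the rank one operator `⟨h, ·⟩ g`. -/
def ambiguity (g h : L2 d) (z : Phase d) : ℂ :=
  Complex.exp (-(Real.pi * Complex.I * (inner ℝ z.1 z.2 : ℝ))) *
    inner ℂ h (timeFreqShift (-z) g)

theorem norm_exp_neg_pi_mul_I (r : ℝ) : ‖Complex.exp (-(Real.pi * Complex.I * r))‖ = 1 := by
  have h : -(Real.pi * Complex.I * r : ℂ) = ((-(Real.pi * r) : ℝ) : ℂ) * Complex.I := by
    push_cast; ring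
  rw [h, Complex.norm_exp_ofReal_mul_I]

theorem norm_ambiguity_le (g h : L2 d) (z : Phase d) : ‖ambiguity g h z‖ ≤ ‖g‖ * ‖h‖ := by
  rw [ambiguity, norm_mul, norm_exp_neg_pi_mul_I, one_mul, mul_comm]
  exact (norm_inner_le_norm _ _).trans_eq (by rw [norm_timeFreqShift_apply])

/-- The product `g(t + x) conj h(t)`. -/
def shiftProd (g h : L2 d) (x t : Config d) : ℂ := g (t + x) * star (h t)

/-- The shift by `-z` evaluates `g` at `t + x` and multiplies by `e^{-2πi ω·t}`, the Fourier kernel.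
This reduces Moyal's identity to Plancherel's theorem for each fixed `x`, and it gives joint
measurability in `z`. -/
theorem inner_timeFreqShift_neg (g h : L2 d) (z : Phase d) :
    inner ℂ h (timeFreqShift (-z) g) = 𝓕 (shiftProd g h z.1) z.2 := by
  rw [L2.inner_def, Real.fourier_eq']
  refine integral_congr_ae ?_
  filter_upwards [timeFreqShift_ae_eq (-z) g] with t ht
  rw [ht, RCLike.inner_apply, shiftFun, shiftProd, Prod.fst_neg, Prod.snd_neg, sub_neg_eq_add,
    inner_neg_left, real_inner_comm, smul_eq_mul, RCLike.star_def, mul_assoc]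
  congr 2
  push_cast
  ring

theorem stronglyMeasurable_shiftProd (g h : L2 d) :
    StronglyMeasurable (Function.uncurry (shiftProd g h)) := by
  have hg : StronglyMeasurable fun p : Config d × Config d => g (p.2 + p.1) :=
    (Lp.stronglyMeasurable g).comp_measurable (by fun_prop)
  have hh : StronglyMeasurable fun p : Config d × Config d => h p.2 :=
    (Lp.stronglyMeasurable h).comp_measurable measurable_snd
  exact hg.mul hh.star

theorem stronglyMeasurable_ambiguity (g h : L2 d) : StronglyMeasurable (ambiguity g h) := by
  have h1 : StronglyMeasurable fun z : Phase d => 𝓕 (shiftProd g h z.1) z.2 := by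
    simp only [Real.fourier_eq']
    have h2 : StronglyMeasurable fun p : Phase d × Config d =>
        Complex.exp ((↑(-2 * Real.pi * inner ℝ p.2 p.1.2) * Complex.I)) •
          shiftProd g h p.1.1 p.2 := by
      have h3 : Continuous fun p : Phase d × Config d =>
          Complex.exp (↑(-2 * Real.pi * inner ℝ p.2 p.1.2) * Complex.I) := by fun_prop
      refine h3.stronglyMeasurable.smul ?_
      exact (stronglyMeasurable_shiftProd g h).comp_measurable
        (g := fun p : Phase d × Config d => (p.1.1, p.2)) (by fun_prop)
    exact h2.integral_prod_right
  refine StronglyMeasurable.mul (Continuous.stronglyMeasurable (by fun_prop)) ?_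
  simpa only [inner_timeFreqShift_neg] using h1

theorem integrable_shiftProd (g h : L2 d) (x : Config d) : Integrable (shiftProd g h x) := by
  have hg : MemLp (fun t => g (t + x)) 2 volume :=
    (Lp.memLp g).comp_measurePreserving (measurePreserving_add_right volume x)
  exact MemLp.integrable_mul hg (Lp.memLp h).star

theorem lintegral_enorm_sq_eq (g : L2 d) : ∫⁻ t, ‖g t‖ₑ ^ 2 = ‖g‖ₑ ^ 2 := by
  rw [Lp.enorm_def, eLpNorm_eq_lintegral_rpow_enorm_toReal two_ne_zero ENNReal.ofNat_ne_top,
    ← ENNReal.rpow_natCast, ← ENNReal.rpow_mul]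
  simp

theorem lintegral_lintegral_shiftProd (g h : L2 d) :
    ∫⁻ x, ∫⁻ t, ‖shiftProd g h x t‖ₑ ^ 2 = ‖g‖ₑ ^ 2 * ‖h‖ₑ ^ 2 := by
  rw [lintegral_lintegral_swap]
  · have h1 : ∀ t, ∫⁻ x, ‖shiftProd g h x t‖ₑ ^ 2 = ‖g‖ₑ ^ 2 * ‖h t‖ₑ ^ 2 := fun t => by
      simp only [shiftProd, enorm_mul, mul_pow, RCLike.star_def, RCLike.enorm_conj]
      rw [lintegral_mul_const', lintegral_add_left_eq_self (fun x => ‖g x‖ₑ ^ 2) t,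
        lintegral_enorm_sq_eq]
      simp
    simp only [h1]
    rw [lintegral_const_mul', lintegral_enorm_sq_eq]
    simp
  · exact ((stronglyMeasurable_shiftProd g h).enorm.pow_const 2).aemeasurable

/-- **Moyal's identity** for the norm. -/
theorem lintegral_enorm_ambiguity_sq (g h : L2 d) :
    ∫⁻ z, ‖ambiguity g h z‖ₑ ^ 2 = ‖g‖ₑ ^ 2 * ‖h‖ₑ ^ 2 := by
  have hm := (stronglyMeasurable_ambiguity g h).enorm.pow_const 2
  have h1 : ∀ z : Phase d, ‖ambiguity g h z‖ₑ = ‖𝓕 (shiftProd g h z.1) z.2‖ₑ := fun z => by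
    rw [ambiguity, enorm_mul, ← ofReal_norm, norm_exp_neg_pi_mul_I, inner_timeFreqShift_neg]
    simp
  rw [Measure.volume_eq_prod, lintegral_prod _ hm.aemeasurable, ← lintegral_lintegral_shiftProd]
  -- A product of two `L²` functions is square integrable only for almost every shift `x`, by
  -- Tonelli; Plancherel is used just there.
  have hfin : ∀ᵐ x, ∫⁻ t, ‖shiftProd g h x t‖ₑ ^ 2 < ∞ := by
    refine ae_lt_top ?_ ?_
    · exact Measurable.lintegral_prod_right'
        ((stronglyMeasurable_shiftProd g h).enorm.pow_const 2)
    · rw [lintegral_lintegral_shiftProd]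
      exact ENNReal.mul_ne_top (by simp) (by simp)
  refine lintegral_congr_ae ?_
  filter_upwards [hfin] with x hx
  simp only [h1]
  refine lintegral_enorm_fourier_sq (integrable_shiftProd g h x)
    ⟨(integrable_shiftProd g h x).1, ?_⟩
  rw [eLpNorm_eq_lintegral_rpow_enorm_toReal two_ne_zero ENNReal.ofNat_ne_top]
  refine ENNReal.rpow_lt_top_of_nonneg (by positivity) ?_
  simpa using hx.ne

theorem eLpNorm_ambiguity (g h : L2 d) : eLpNorm (ambiguity g h) 2 volume = ‖g‖ₑ * ‖h‖ₑ := by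
  rw [eLpNorm_eq_lintegral_rpow_enorm_toReal two_ne_zero ENNReal.ofNat_ne_top]
  simp only [ENNReal.toReal_ofNat, ENNReal.rpow_ofNat, lintegral_enorm_ambiguity_sq]
  rw [← mul_pow, ← ENNReal.rpow_natCast, ← ENNReal.rpow_mul]
  simp

theorem memLp_ambiguity (g h : L2 d) : MemLp (ambiguity g h) 2 volume :=
  ⟨(stronglyMeasurable_ambiguity g h).aestronglyMeasurable, by
    rw [eLpNorm_ambiguity]; exact ENNReal.mul_lt_top (by simp) (by simp)⟩

/-- The ambiguity function as an element of `L²`. -/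
def ambiguityLp (g h : L2 d) : Lp ℂ 2 (volume : Measure (Phase d)) :=
  (memLp_ambiguity g h).toLp

theorem norm_ambiguityLp (g h : L2 d) : ‖ambiguityLp g h‖ = ‖g‖ * ‖h‖ := by
  rw [ambiguityLp, Lp.norm_toLp, eLpNorm_ambiguity, ENNReal.toReal_mul, toReal_enorm, toReal_enorm]

/-- **Moyal's identity**. -/
theorem inner_ambiguityLp (g h g' h' : L2 d) :
    inner ℂ (ambiguityLp g h) (ambiguityLp g' h') = inner ℂ g g' * inner ℂ h' h := by
  refine inner_eq_of_norm_eq_mul norm_ambiguityLp (fun g g' h => ?_) (fun c g h => ?_)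
    (fun g h h' => ?_) (fun c g h => ?_) g g' h h'
  · rw [ambiguityLp, ambiguityLp, ambiguityLp, ← MemLp.toLp_add, MemLp.toLp_eq_toLp_iff]
    refine Eventually.of_forall fun z => ?_
    simp only [ambiguity, Pi.add_apply, map_add, inner_add_right, mul_add]
  · rw [ambiguityLp, ambiguityLp, ← MemLp.toLp_const_smul, MemLp.toLp_eq_toLp_iff]
    refine Eventually.of_forall fun z => ?_
    simp only [ambiguity, Pi.smul_apply, map_smul, inner_smul_right, smul_eq_mul]
    ring
  · rw [ambiguityLp, ambiguityLp, ambiguityLp, ← MemLp.toLp_add, MemLp.toLp_eq_toLp_iff]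
    refine Eventually.of_forall fun z => ?_
    simp only [ambiguity, Pi.add_apply, inner_add_left, mul_add]
  · rw [ambiguityLp, ambiguityLp, ← MemLp.toLp_const_smul, MemLp.toLp_eq_toLp_iff]
    refine Eventually.of_forall fun z => ?_
    simp only [ambiguity, Pi.smul_apply, inner_smul_left, smul_eq_mul, RCLike.star_def]
    ring

/-- Together with `norm_ambiguity_le` this provides the uniformly bounded orthonormal system for
Riesz's inequality. -/
theorem orthonormal_ambiguityLp {ι : Type*} {e f : ι → L2 d} (he : Orthonormal ℂ e)
    (hf : Orthonormal ℂ f) : Orthonormal ℂ fun i => ambiguityLp (f i) (e i) := by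
  refine ⟨fun i => by rw [norm_ambiguityLp, he.1, hf.1, one_mul], fun i j hij => ?_⟩
  simp only [inner_ambiguityLp, hf.2 hij, zero_mul]

end Ambiguity

theorem hasSum_sumElim {α β M : Type*} [AddCommMonoid M] [TopologicalSpace M] [ContinuousAdd M]
    {f : α → M} {g : β → M} {a b : M} (hf : HasSum f a) (hg : HasSum g b) :
    HasSum (Sum.elim f g) (a + b) :=
  HasSum.sum (by rwa [Sum.elim_comp_inl]) (by rwa [Sum.elim_comp_inr])

theorem enorm_sub_sq_le {E : Type*} [NormedAddCommGroup E] (x y : E) :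
    ‖x - y‖ₑ ^ 2 ≤ 2 * ‖x‖ₑ ^ 2 + 2 * ‖y‖ₑ ^ 2 := by
  simp only [enorm_sq_eq_ofReal]
  rw [← ENNReal.ofReal_ofNat 2, ← ENNReal.ofReal_mul zero_le_two,
    ← ENNReal.ofReal_mul zero_le_two, ← ENNReal.ofReal_add (by positivity) (by positivity)]
  refine ENNReal.ofReal_le_ofReal ?_
  nlinarith [sq_nonneg (‖x‖ - ‖y‖), norm_sub_le x y, norm_nonneg (x - y)]

/-! ### Summability of singular values and finite partial sums of the decomposition. -/

section SchmidtSums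

variable {H : Type*} [NormedAddCommGroup H] [InnerProductSpace ℂ H] [CompleteSpace H]
  {T : H →L[ℂ] H}

namespace SchmidtDecomposition

theorem tsum_rpow_ne_top (D : SchmidtDecomposition T) {p : ℝ} (hp : 0 < p)
    (hT : MemSchatten p T) : ∑' i, ENNReal.ofReal (D.s i) ^ p ≠ ∞ := by
  intro h
  rw [MemSchatten, D.schattenENorm_eq, h, ENNReal.top_rpow_of_pos (by positivity)] at hT
  exact lt_irrefl _ hT

/-- A finite sum in `[0, ∞]` has countably many nonzero terms, and every term here is positive.
Countability lets null sets be united and the net of finite index sets be replaced by a sequence. -/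
theorem countable_index (D : SchmidtDecomposition T) {p : ℝ} (hp : 0 < p)
    (hT : MemSchatten p T) : Countable D.ι := by
  have h := Summable.countable_support_ennreal (D.tsum_rpow_ne_top hp hT)
  have h2 : (Function.support fun i => ENNReal.ofReal (D.s i) ^ p) = Set.univ := by
    refine Set.eq_univ_of_forall fun i => ?_
    have := D.pos i
    simp [ENNReal.rpow_eq_zero_iff, this]
  rw [h2] at h
  exact Set.countable_univ_iff.1 h

theorem summable_rpow (D : SchmidtDecomposition T) {p : ℝ} (hp : 0 < p)
    (hT : MemSchatten p T) : Summable fun i => D.s i ^ p := by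
  refine (ENNReal.summable_toReal (D.tsum_rpow_ne_top hp hT)).congr fun i => ?_
  rw [ENNReal.ofReal_rpow_of_pos (D.pos i), ENNReal.toReal_ofReal]
  exact Real.rpow_nonneg (D.pos i).le _

/-- The inclusion of `ℓ^p` in `ℓ²` for `p ≤ 2`, by which operators in `𝒯^p` are Hilbert–Schmidt. -/
theorem summable_sq (D : SchmidtDecomposition T) {p : ℝ} (hp : 0 < p) (hp2 : p ≤ 2)
    (hT : MemSchatten p T) : Summable fun i => D.s i ^ 2 := by
  have h1 : Memℓp D.s (ENNReal.ofReal p) := by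
    refine memℓp_gen ((D.summable_rpow hp hT).congr fun i => ?_)
    rw [ENNReal.toReal_ofReal hp.le, Real.norm_of_nonneg (D.pos i).le]
  have h2 : Memℓp D.s 2 :=
    h1.of_exponent_ge (by simpa using ENNReal.ofReal_le_ofReal hp2)
  refine (h2.summable (by simp)).congr fun i => ?_
  rw [Real.norm_of_nonneg (D.pos i).le]
  simp

theorem summable_norm_mul_norm (D : SchmidtDecomposition T) (hT : MemSchatten 1 T) :
    Summable fun i => ‖(D.s i : ℂ) • D.f i‖ * ‖D.e i‖ := by
  refine (D.summable_rpow one_pos hT).congr fun i => ?_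
  rw [norm_smul, D.orthonormal_e.1, D.orthonormal_f.1, Complex.norm_real,
    Real.norm_of_nonneg (D.pos i).le, Real.rpow_one, mul_one, mul_one]

theorem hasSum_inner_smul (D : SchmidtDecomposition T) (x : H) :
    HasSum (fun i => inner ℂ (D.e i) x • ((D.s i : ℂ) • D.f i)) (T x) := by
  simpa only [smul_smul, mul_comm] using D.hasSum x

/-- The part of the singular value decomposition with index in `A`. -/
def partialSum (D : SchmidtDecomposition T) (A : Finset D.ι) : H →L[ℂ] H :=
  ∑ i ∈ A, (innerSL ℂ (D.e i)).smulRight ((D.s i : ℂ) • D.f i)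

theorem partialSum_apply (D : SchmidtDecomposition T) (A : Finset D.ι) (x : H) :
    D.partialSum A x = ∑ i ∈ A, inner ℂ (D.e i) x • ((D.s i : ℂ) • D.f i) := by
  simp [partialSum]

theorem finiteDimensional_range_partialSum (D : SchmidtDecomposition T) (A : Finset D.ι) :
    FiniteDimensional ℂ (LinearMap.range (D.partialSum A : H →ₗ[ℂ] H)) := by
  classical
  have : FiniteDimensional ℂ (Submodule.span ℂ (A.image D.f : Set H)) :=
    FiniteDimensional.span_finset ℂ _
  refine Submodule.finiteDimensional_of_le (S₂ := Submodule.span ℂ (A.image D.f : Set H)) ?_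
  rintro _ ⟨x, rfl⟩
  change D.partialSum A x ∈ _
  rw [partialSum_apply]
  refine Submodule.sum_mem _ fun i hi => Submodule.smul_mem _ _ (Submodule.smul_mem _ _
    (Submodule.subset_span ?_))
  exact Finset.mem_coe.2 (Finset.mem_image_of_mem _ hi)

/-- The remainder is again an expansion in orthonormal systems, indexed by the complement of `A`. -/
theorem schattenENorm_two_partialSum_sub_sq (D : SchmidtDecomposition T)
    (hT : IsCompactOperator T) (A : Finset D.ι) :
    schattenENorm 2 (D.partialSum A - T) ^ 2 = ∑' i : {i // i ∉ A}, ‖(D.s i : ℂ)‖ₑ ^ 2 := by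
  obtain ⟨w, b, -⟩ := exists_hilbertBasis ℂ H
  have hc := isCompactOperator_of_finiteDimensional_range (D.finiteDimensional_range_partialSum A)
  rw [schattenENorm_two_sq b (hc.sub hT)]
  have h1 := tsum_enorm_sq_eq_of_hasSum b (R := fun x => T x - D.partialSum A x)
    (D.orthonormal_e.comp (Subtype.val : {i // i ∉ A} → D.ι) Subtype.val_injective)
    (D.orthonormal_f.comp (Subtype.val : {i // i ∉ A} → D.ι) Subtype.val_injective)
    (c := fun i => (D.s i : ℂ)) (fun x => by
      have h2 := (Finset.hasSum_iff_compl A).1 (D.hasSum_inner_smul x)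
      rw [← partialSum_apply] at h2
      simpa only [Function.comp_apply, smul_smul, mul_comm] using h2)
  rw [← h1]
  refine tsum_congr fun n => ?_
  rw [sub_apply, ← enorm_neg, neg_sub]

theorem tendsto_schattenENorm_two_partialSum_sub (D : SchmidtDecomposition T)
    (hT : IsCompactOperator T) (hs : Summable fun i => D.s i ^ 2) :
    Tendsto (fun A => schattenENorm 2 (D.partialSum A - T)) atTop (𝓝 0) := by
  have h1 : ∑' i, ‖(D.s i : ℂ)‖ₑ ^ 2 ≠ ∞ := by
    have h3 : ∀ i, ‖(D.s i : ℂ)‖ₑ ^ 2 = ENNReal.ofReal (D.s i ^ 2) := fun i => by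
      rw [enorm_sq_eq_ofReal, Complex.norm_real, Real.norm_of_nonneg (D.pos i).le]
    simp only [h3]
    rw [← ENNReal.ofReal_tsum_of_nonneg (fun i => by positivity) hs]
    exact ENNReal.ofReal_ne_top
  have h2 := (ENNReal.tendsto_tsum_compl_atTop_zero h1).ennrpow_const (1 / 2)
  rw [ENNReal.zero_rpow_of_pos (by norm_num)] at h2
  refine h2.congr fun A => ?_
  rw [← D.schattenENorm_two_partialSum_sub_sq hT A, ← ENNReal.rpow_natCast, ← ENNReal.rpow_mul]
  norm_num

end SchmidtDecomposition

end SchmidtSums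

/-! ### The Fourier–Wigner transform: isometry, extension and the bound for partial sums. -/

section Transform

variable {d : ℕ}

theorem sum_ambiguity_bound {ι : Type*} [Fintype ι] {e f : ι → L2 d} (he : Orthonormal ℂ e)
    (hf : Orthonormal ℂ f) (a : ι → ℂ) :
    Integrable (fun z => ‖∑ i, a i * ambiguity (f i) (e i) z‖ ^ 2) ∧
      ∫ z, ‖∑ i, a i * ambiguity (f i) (e i) z‖ ^ 2 ≤ ∑ i, ‖a i‖ ^ 2 := by
  have hm : MemLp (fun z => ∑ i, a i * ambiguity (f i) (e i) z) 2 volume :=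
    memLp_finsetSum _ fun i _ => (memLp_ambiguity (f i) (e i)).const_mul (a i)
  have hi := (memLp_two_iff_integrable_sq_norm hm.1).1 hm
  refine ⟨hi, ?_⟩
  have h1 : hm.toLp = ∑ i, a i • ambiguityLp (f i) (e i) := by
    refine Lp.ext (hm.coeFn_toLp.trans ?_)
    have h2 : ∀ᵐ z ∂(volume : Measure (Phase d)), ∀ i,
        (a i • ambiguityLp (f i) (e i) : Lp ℂ 2 (volume : Measure (Phase d))) z
          = a i * ambiguity (f i) (e i) z := by
      refine ae_all_iff.2 fun i => ?_
      filter_upwards [Lp.coeFn_smul (a i) (ambiguityLp (f i) (e i)),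
        (memLp_ambiguity (f i) (e i)).coeFn_toLp] with z hz hz2
      rw [hz, Pi.smul_apply, smul_eq_mul, ambiguityLp, hz2]
    filter_upwards [Lp.coeFn_fun_finsetSum Finset.univ fun i => a i • ambiguityLp (f i) (e i), h2]
      with z hz hz2
    rw [hz]
    exact Finset.sum_congr rfl fun i _ => (hz2 i).symm
  have h3 : ‖hm.toLp‖ ^ 2 = ∑ i, ‖a i‖ ^ 2 := by
    rw [h1]
    simpa using (orthonormal_ambiguityLp he hf).orthogonalFamily.norm_sum a Finset.univ
  rw [← h3, Lp.norm_toLp, integral_eq_lintegral_of_nonneg_ae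
    (Eventually.of_forall fun z => by positivity) hi.1,
    eLpNorm_eq_lintegral_rpow_enorm_toReal two_ne_zero ENNReal.ofNat_ne_top, ← ENNReal.toReal_pow,
    ← ENNReal.rpow_natCast, ← ENNReal.rpow_mul]
  simp only [← enorm_sq_eq_ofReal]
  simp

/-- The bound `‖g k‖ ‖h k‖` on each ambiguity function gives absolute convergence at every point,
and the trace is computed from the nuclear series. -/
theorem hasSum_ambiguity {κ : Type*} {g h : κ → L2 d} (hgh : Summable fun k => ‖g k‖ * ‖h k‖)
    {R : Op d} (hR : ∀ x, HasSum (fun k => inner ℂ (h k) x • g k) (R x)) (z : Phase d) :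
    HasSum (fun k => ambiguity (g k) (h k) z) (fourierWigner R z) := by
  have h1 : Summable fun k => ambiguity (g k) (h k) z :=
    Summable.of_norm_bounded hgh fun k => norm_ambiguity_le _ _ z
  have h2 : fourierWigner R z = ∑' k, ambiguity (g k) (h k) z := by
    rw [fourierWigner, trace_eq_tsum_inner (g := fun k => timeFreqShift (-z) (g k)) (h := h)
      (by simpa only [norm_timeFreqShift_apply] using hgh) (fun x => ?_), ← tsum_mul_left]
    · rfl
    · simpa only [ContinuousLinearMap.comp_apply, map_smul] using (hR x).mapL (timeFreqShift (-z))
  rw [h2]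
  exact h1.hasSum

theorem fourierWigner_ae_eq_tsum {κ : Type*} [Countable κ] {g h : κ → L2 d}
    (hgh : Summable fun k => ‖g k‖ * ‖h k‖) {Φ : Phase d → ℂ}
    (hΦ : ∀ z, HasSum (fun k => ambiguity (g k) (h k) z) (Φ z)) :
    Φ =ᵐ[volume] (∑' k, ambiguityLp (g k) (h k) : Lp ℂ 2 (volume : Measure (Phase d))) := by
  have h1 : ∑' k, ‖ambiguityLp (g k) (h k)‖ₑ ≠ ∞ := by
    refine tsum_enorm_ne_top_iff_summable_norm.2 ?_
    simpa only [norm_ambiguityLp] using hgh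
  have h2 : ∀ᵐ z ∂(volume : Measure (Phase d)), ∀ k,
      ambiguityLp (g k) (h k) z = ambiguity (g k) (h k) z :=
    ae_all_iff.2 fun k => (memLp_ambiguity (g k) (h k)).coeFn_toLp
  filter_upwards [Lp.coeFn_tsum h1, h2] with z hz hz2
  rw [hz, ← (hΦ z).tsum_eq]
  exact tsum_congr fun k => (hz2 k).symm

/-- The Fourier-Wigner transform of nuclear operators is isometric for the Hilbert-Schmidt norm. -/
theorem memLp_and_eLpNorm_sq_of_hasSum {κ ι : Type*} [Countable κ] (b : HilbertBasis ι ℂ (L2 d))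
    {g h : κ → L2 d} (hgh : Summable fun k => ‖g k‖ * ‖h k‖) {R : L2 d → L2 d}
    (hR : ∀ x, HasSum (fun k => inner ℂ (h k) x • g k) (R x)) {Φ : Phase d → ℂ}
    (hΦ : ∀ z, HasSum (fun k => ambiguity (g k) (h k) z) (Φ z)) :
    MemLp Φ 2 volume ∧ eLpNorm Φ 2 volume ^ 2 = ∑' n, ‖R (b n)‖ₑ ^ 2 := by
  have h1 := fourierWigner_ae_eq_tsum hgh hΦ
  refine ⟨(memLp_congr_ae h1).2 (Lp.memLp _), ?_⟩
  obtain ⟨hs, h2⟩ := tsum_enorm_sq_eq_enorm_tsum_rankOneLp b hgh hR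
  have hs' : Summable fun k => ambiguityLp (g k) (h k) :=
    Summable.of_norm (by simpa only [norm_ambiguityLp] using hgh)
  -- The ambiguity functions and the rank one operators have the same Gram matrix, so their sums
  -- have the same norm.
  rw [h2, eLpNorm_congr_ae h1, ← Lp.enorm_def, ← ofReal_norm, ← ofReal_norm,
    norm_tsum_eq_of_inner_eq (fun i j => ?_) hs' hs]
  rw [inner_ambiguityLp, inner_rankOneLp]

theorem memLp_fourierWigner {T : Op d} (hT : MemSchatten 1 T) :
    MemLp (fourierWigner T) 2 volume := by
  obtain ⟨w, b, -⟩ := exists_hilbertBasis ℂ (L2 d)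
  obtain ⟨D⟩ := nonempty_schmidtDecomposition (isCompactOperator_of_memSchatten hT)
  have := D.countable_index one_pos hT
  exact (memLp_and_eLpNorm_sq_of_hasSum b (D.summable_norm_mul_norm hT) D.hasSum_inner_smul
    (hasSum_ambiguity (D.summable_norm_mul_norm hT) D.hasSum_inner_smul)).1

theorem eLpNorm_fourierWigner_sub_sq {ι : Type*} (b : HilbertBasis ι ℂ (L2 d)) {T T' : Op d}
    (hT : MemSchatten 1 T) (hT' : MemSchatten 1 T') :
    eLpNorm (fourierWigner T - fourierWigner T') 2 volume ^ 2
      = ∑' n, ‖T (b n) - T' (b n)‖ₑ ^ 2 := by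
  obtain ⟨D⟩ := nonempty_schmidtDecomposition (isCompactOperator_of_memSchatten hT)
  obtain ⟨D'⟩ := nonempty_schmidtDecomposition (isCompactOperator_of_memSchatten hT')
  have := D.countable_index one_pos hT
  have := D'.countable_index one_pos hT'
  -- The difference is one nuclear series, the two decompositions side by side. No decomposition of
  -- `T - T'` itself is needed.
  let g : D.ι ⊕ D'.ι → L2 d :=
    Sum.elim (fun i => (D.s i : ℂ) • D.f i) (fun i => -((D'.s i : ℂ) • D'.f i))
  let h : D.ι ⊕ D'.ι → L2 d := Sum.elim D.e D'.e
  have hsum := D.summable_norm_mul_norm hT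
  have hsum' := D'.summable_norm_mul_norm hT'
  have hgh : Summable fun k => ‖g k‖ * ‖h k‖ := by
    refine (hasSum_sumElim hsum.hasSum hsum'.hasSum).summable.congr ?_
    rintro (i | i) <;> simp [g, h]
  have hR : ∀ x, HasSum (fun k => inner ℂ (h k) x • g k) (T x - T' x) := fun x => by
    rw [sub_eq_add_neg]
    convert! hasSum_sumElim (D.hasSum_inner_smul x) (D'.hasSum_inner_smul x).neg using 1
    funext k
    rcases k with i | i <;> simp [g, h]
  refine (memLp_and_eLpNorm_sq_of_hasSum b hgh hR fun z => ?_).2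
  rw [Pi.sub_apply, sub_eq_add_neg]
  convert! hasSum_sumElim (hasSum_ambiguity hsum D.hasSum_inner_smul z)
    (hasSum_ambiguity hsum' D'.hasSum_inner_smul z).neg using 1
  funext k
  rcases k with i | i <;> simp [g, h, ambiguity, inner_neg_right]

/-- By the isometry this is a statement about Hilbert–Schmidt norms. Writing `T - T'` as `(T - S) -
(T' - S)` and using `enorm_sub_sq_le` on each basis vector replaces a triangle inequality for
`schattenENorm`. -/
theorem tendsto_eLpNorm_fourierWigner_sub {S : Op d} (hS : IsCompactOperator S) {T T' : ℕ → Op d}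
    (hT : ∀ n, MemSchatten 1 (T n)) (hT' : ∀ n, MemSchatten 1 (T' n))
    (h : Tendsto (fun n => schattenENorm 2 (T n - S)) atTop (𝓝 0))
    (h' : Tendsto (fun n => schattenENorm 2 (T' n - S)) atTop (𝓝 0)) :
    Tendsto (fun n => eLpNorm (fourierWigner (T n) - fourierWigner (T' n)) 2 volume)
      atTop (𝓝 0) := by
  obtain ⟨w, b, -⟩ := exists_hilbertBasis ℂ (L2 d)
  have hle : ∀ n, eLpNorm (fourierWigner (T n) - fourierWigner (T' n)) 2 volume ^ 2 ≤
      2 * schattenENorm 2 (T n - S) ^ 2 + 2 * schattenENorm 2 (T' n - S) ^ 2 := by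
    intro n
    rw [eLpNorm_fourierWigner_sub_sq b (hT n) (hT' n),
      schattenENorm_two_sq b ((isCompactOperator_of_memSchatten (hT n)).sub hS),
      schattenENorm_two_sq b ((isCompactOperator_of_memSchatten (hT' n)).sub hS),
      ← ENNReal.tsum_mul_left, ← ENNReal.tsum_mul_left, ← ENNReal.tsum_add]
    refine ENNReal.tsum_le_tsum fun k => ?_
    rw [sub_apply, sub_apply, ← sub_sub_sub_cancel_right (T n (b k)) (T' n (b k)) (S (b k))]
    exact enorm_sub_sq_le _ _
  have hz : Tendsto (fun n => 2 * schattenENorm 2 (T n - S) ^ 2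
      + 2 * schattenENorm 2 (T' n - S) ^ 2) atTop (𝓝 0) := by
    have h1 := ENNReal.Tendsto.const_mul (a := 2) (h.ennrpow_const 2) (Or.inr (by simp))
    have h2 := ENNReal.Tendsto.const_mul (a := 2) (h'.ennrpow_const 2) (Or.inr (by simp))
    simpa using h1.add h2
  have h3 := (tendsto_of_tendsto_of_tendsto_of_le_of_le tendsto_const_nhds hz
    (fun _ => zero_le) hle).ennrpow_const (1 / 2)
  rw [ENNReal.zero_rpow_of_pos (by norm_num)] at h3
  refine h3.congr fun n => ?_
  rw [← ENNReal.rpow_natCast, ← ENNReal.rpow_mul]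
  norm_num

theorem IsFourierWigner.ae_eq {S : Op d} (hS : IsCompactOperator S) {F G : Phase d → ℂ}
    (hF : IsFourierWigner S F) (hG : IsFourierWigner S G) : F =ᵐ[volume] G := by
  obtain ⟨hF2, T, hT, hTS, hTF⟩ := hF
  obtain ⟨hG2, T', hT', hTS', hTG⟩ := hG
  have h1 := tendsto_eLpNorm_fourierWigner_sub hS hT hT' hTS hTS'
  have hle : ∀ n, eLpNorm (F - G) 2 volume ≤ eLpNorm (fourierWigner (T n) - F) 2 volume +
      (eLpNorm (fourierWigner (T n) - fourierWigner (T' n)) 2 volume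
        + eLpNorm (fourierWigner (T' n) - G) 2 volume) := by
    intro n
    have m := (memLp_fourierWigner (hT n)).1
    have m' := (memLp_fourierWigner (hT' n)).1
    have e : F - G = (F - fourierWigner (T n)) + ((fourierWigner (T n) - fourierWigner (T' n))
        + (fourierWigner (T' n) - G)) := by abel
    rw [e, eLpNorm_sub_comm (fourierWigner (T n)) F]
    refine (eLpNorm_add_le (hF2.1.sub m) ((m.sub m').add (m'.sub hG2.1)) one_le_two).trans ?_
    gcongr
    exact eLpNorm_add_le (m.sub m') (m'.sub hG2.1) one_le_two
  have h2 := ge_of_tendsto' (hTF.add (h1.add hTG)) hle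
  simp only [add_zero, nonpos_iff_eq_zero] at h2
  have h3 := (eLpNorm_eq_zero_iff (hF2.1.sub hG2.1) two_ne_zero).1 h2
  filter_upwards [h3] with z hz
  exact sub_eq_zero.1 hz

theorem schattenENorm_two_zero : schattenENorm 2 (0 : Op d) = 0 := by
  obtain ⟨w, b, -⟩ := exists_hilbertBasis ℂ (L2 d)
  have := schattenENorm_two_sq b (T := (0 : Op d)) isCompactOperator_zero
  simpa using this

theorem isFourierWigner_fourierWigner {S : Op d} (hS : MemSchatten 1 S) :
    IsFourierWigner S (fourierWigner S) := by
  refine ⟨memLp_fourierWigner hS, fun _ => S, fun _ => hS, ?_, ?_⟩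
  · simp [schattenENorm_two_zero]
  · simp

theorem fourierWigner_partialSum {S : Op d} (D : SchmidtDecomposition S) (A : Finset D.ι)
    (z : Phase d) :
    fourierWigner (D.partialSum A) z = ∑ i : A, (D.s i : ℂ) * ambiguity (D.f i) (D.e i) z := by
  have h1 := hasSum_ambiguity (κ := A) (g := fun i => (D.s i : ℂ) • D.f i) (h := fun i => D.e i)
    (R := D.partialSum A) (Summable.of_finite) (fun x => by
      rw [D.partialSum_apply, ← Finset.sum_coe_sort A]
      exact hasSum_fintype _) z
  refine (h1.unique (hasSum_fintype _)).trans (Finset.sum_congr rfl fun i _ => ?_)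
  simp only [ambiguity, map_smul, inner_smul_right]
  ring

/-- The Fourier-Wigner transform of a Hilbert-Schmidt operator, as the sum of an orthogonal
series. -/
def transformLp {S : Op d} (D : SchmidtDecomposition S) : Lp ℂ 2 (volume : Measure (Phase d)) :=
  ∑' i, (D.s i : ℂ) • ambiguityLp (D.f i) (D.e i)

theorem fourierWigner_partialSum_ae_eq {S : Op d} (D : SchmidtDecomposition S) (A : Finset D.ι) :
    fourierWigner (D.partialSum A) =ᵐ[volume]
      (∑ i ∈ A, (D.s i : ℂ) • ambiguityLp (D.f i) (D.e i) :
        Lp ℂ 2 (volume : Measure (Phase d))) := by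
  have h2 : ∀ᵐ z ∂(volume : Measure (Phase d)), ∀ i ∈ A,
      ((D.s i : ℂ) • ambiguityLp (D.f i) (D.e i) : Lp ℂ 2 (volume : Measure (Phase d))) z
        = (D.s i : ℂ) * ambiguity (D.f i) (D.e i) z := by
    refine (Finset.eventually_all A).2 fun i _ => ?_
    filter_upwards [Lp.coeFn_smul (D.s i : ℂ) (ambiguityLp (D.f i) (D.e i)),
      (memLp_ambiguity (D.f i) (D.e i)).coeFn_toLp] with z hz hz2
    rw [hz, Pi.smul_apply, smul_eq_mul, ambiguityLp, hz2]
  filter_upwards [Lp.coeFn_fun_finsetSum A fun i => (D.s i : ℂ) • ambiguityLp (D.f i) (D.e i), h2]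
    with z hz hz2
  rw [hz, fourierWigner_partialSum,
    Finset.sum_coe_sort A fun i => (D.s i : ℂ) * ambiguity (D.f i) (D.e i) z]
  exact Finset.sum_congr rfl fun i hi => (hz2 i hi).symm

/-- An orthogonal series in `L²` with square summable coefficients converges unconditionally. -/
theorem tendsto_eLpNorm_partialSum_sub {S : Op d} (D : SchmidtDecomposition S)
    (hs : Summable fun i => D.s i ^ 2) :
    Tendsto (fun A => eLpNorm (fourierWigner (D.partialSum A) -
      (transformLp D : Phase d → ℂ)) 2 volume)
      atTop (𝓝 0) := by
  have ho := orthonormal_ambiguityLp D.orthonormal_e D.orthonormal_f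
  have hsum : Summable fun i => (D.s i : ℂ) • ambiguityLp (D.f i) (D.e i) := by
    have h := ho.orthogonalFamily.summable_iff_norm_sq_summable (fun i => (D.s i : ℂ))
    simp only [LinearIsometry.toSpanSingleton_apply] at h
    refine h.2 (hs.congr fun i => ?_)
    rw [Complex.norm_real, Real.norm_of_nonneg (D.pos i).le]
  have h1 := (Lp.tendsto_Lp_iff_tendsto_eLpNorm' _ _).1 hsum.hasSum
  refine h1.congr fun A => eLpNorm_congr_ae ?_
  exact (fourierWigner_partialSum_ae_eq D A).symm.sub (ae_eq_refl _)

theorem memSchatten_one_partialSum {S : Op d} (D : SchmidtDecomposition S) (A : Finset D.ι) :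
    MemSchatten 1 (D.partialSum A) :=
  memSchatten_of_finiteDimensional_range zero_le_one (D.finiteDimensional_range_partialSum A)

theorem isFourierWigner_transformLp {S : Op d} (D : SchmidtDecomposition S) {p : ℝ} (hp : 0 < p)
    (hp2 : p ≤ 2) (hS : MemSchatten p S) : IsFourierWigner S (transformLp D) := by
  have := D.countable_index hp hS
  obtain ⟨A, hA⟩ := exists_seq_tendsto (atTop : Filter (Finset D.ι))
  have hs := D.summable_sq hp hp2 hS
  exact ⟨Lp.memLp _, fun n => D.partialSum (A n), fun n => memSchatten_one_partialSum D _,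
    (D.tendsto_schattenENorm_two_partialSum_sub (isCompactOperator_of_memSchatten hS) hs).comp hA,
    (tendsto_eLpNorm_partialSum_sub D hs).comp hA⟩

/-- For `p = 1` this is the triangle inequality with `‖φ i‖ ≤ 1`; for `p > 1` it is Riesz's
inequality. The bound is uniform in `A`, as Fatou's lemma demands. -/
theorem eLpNorm_partialSum_le {S : Op d} (D : SchmidtDecomposition S) {p : ℝ} (hp1 : 1 ≤ p)
    (hp2 : p ≤ 2) {q : ℝ≥0∞} (hpq : 1 / ENNReal.ofReal p + 1 / q = 1) (A : Finset D.ι) :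
    eLpNorm (fourierWigner (D.partialSum A)) q volume ≤ schattenENorm p S := by
  have hp0 : 0 < p := one_pos.trans_le hp1
  have hb : ∀ i z, ‖ambiguity (D.f i) (D.e i) z‖ ≤ 1 := fun i z => by
    simpa [D.orthonormal_e.1, D.orthonormal_f.1] using norm_ambiguity_le (D.f i) (D.e i) z
  have hA : (∑ i : A, ENNReal.ofReal (D.s i) ^ p) ^ (1 / p) ≤ schattenENorm p S := by
    rw [D.schattenENorm_eq, Finset.sum_coe_sort A fun i => ENNReal.ofReal (D.s i) ^ p]
    exact ENNReal.rpow_le_rpow (ENNReal.sum_le_tsum A) (by positivity)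
  refine le_trans ?_ hA
  rcases hp1.eq_or_lt with rfl | hp
  · have hq : q = ∞ := by
      have : 1 + 1 / q = 1 + 0 := by simpa using hpq
      simpa using (ENNReal.add_right_inj ENNReal.one_ne_top).1 this
    rw [hq, eLpNorm_exponent_top]
    refine eLpNormEssSup_le_of_ae_enorm_bound (Eventually.of_forall fun z => ?_)
    rw [fourierWigner_partialSum]
    simp only [ENNReal.rpow_one, div_one]
    refine (enorm_sum_le _ _).trans (Finset.sum_le_sum fun i _ => ?_)
    rw [← ofReal_norm]
    refine ENNReal.ofReal_le_ofReal ?_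
    rw [norm_mul, Complex.norm_real, Real.norm_of_nonneg (D.pos i).le]
    exact mul_le_of_le_one_right (D.pos i).le (hb i z)
  · have hc := Real.HolderConjugate.conjExponent hp
    set r := p.conjExponent
    have hr0 : 0 < r := hc.symm.pos
    have hq : q = ENNReal.ofReal r := by
      have h1 : 1 / ENNReal.ofReal p + 1 / ENNReal.ofReal r = 1 := by
        rw [one_div, one_div, ← ENNReal.ofReal_inv_of_pos hp0, ← ENNReal.ofReal_inv_of_pos hr0,
          ← ENNReal.ofReal_add (by positivity) (by positivity), hc.inv_add_inv_eq_one,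
          ENNReal.ofReal_one]
      have h2 : 1 / ENNReal.ofReal p ≠ ∞ := by simp [hp0]
      have h3 := (ENNReal.add_right_inj h2).1 (hpq.trans h1.symm)
      rwa [one_div, one_div, inv_inj] at h3
    rw [hq, eLpNorm_eq_lintegral_rpow_enorm_toReal (by simpa using hr0) ENNReal.ofReal_ne_top,
      ENNReal.toReal_ofReal hr0.le]
    have h4 := lintegral_enorm_sum_rpow_le (μ := (volume : Measure (Phase d))) hc hp2
      (φ := fun i : A => ambiguity (D.f i) (D.e i))
      (fun i => (stronglyMeasurable_ambiguity _ _).aestronglyMeasurable) (fun i z => hb i z)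
      (sum_ambiguity_bound (D.orthonormal_e.comp _ Subtype.val_injective)
        (D.orthonormal_f.comp _ Subtype.val_injective)) (s := fun i => D.s i) (fun i => D.pos i)
    simp only [fourierWigner_partialSum]
    refine (ENNReal.rpow_le_rpow h4 (by positivity)).trans_eq ?_
    have h5 : 0 ≤ ∑ i : A, D.s i ^ p :=
      Finset.sum_nonneg fun i _ => Real.rpow_nonneg (D.pos i).le _
    rw [ENNReal.ofReal_rpow_of_nonneg (by positivity) (by positivity), ← Real.rpow_mul h5,
      ← ENNReal.ofReal_rpow_of_nonneg h5 (by positivity), ENNReal.ofReal_sum_of_nonneg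
        (s := Finset.univ) (f := fun i : A => D.s i ^ p)
        fun i _ => Real.rpow_nonneg (D.pos i).le _]
    congr 1
    · exact Finset.sum_congr rfl fun i _ => (ENNReal.ofReal_rpow_of_pos (D.pos i)).symm
    · field_simp

end Transform

end FourierWigner

end

theorem mainTheorem6 (d : ℕ) (p : ℝ) (hp1 : 1 ≤ p) (hp2 : p ≤ 2) (q : ℝ≥0∞)
    (hpq : 1 / ENNReal.ofReal p + 1 / q = 1)
    (S : FourierWigner.Op d) (hS : FourierWigner.MemSchatten p S) :
    -- the (extended) transform of `S` is well defined, and it is the trace formula on `𝒯^1`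
    (∃ F : FourierWigner.Phase d → ℂ, FourierWigner.IsFourierWigner S F) ∧
    (∀ F G : FourierWigner.Phase d → ℂ, FourierWigner.IsFourierWigner S F →
      FourierWigner.IsFourierWigner S G → F =ᵐ[volume] G) ∧
    (FourierWigner.MemSchatten 1 S →
      FourierWigner.IsFourierWigner S (FourierWigner.fourierWigner S)) ∧
    -- the inequality
    (∀ F : FourierWigner.Phase d → ℂ, FourierWigner.IsFourierWigner S F →
      MemLp F q volume ∧ eLpNorm F q volume ≤ FourierWigner.schattenENorm p S) := by
  have hp0 : 0 < p := one_pos.trans_le hp1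
  have hc := FourierWigner.isCompactOperator_of_memSchatten hS
  obtain ⟨D⟩ := FourierWigner.nonempty_schmidtDecomposition hc
  have hD := FourierWigner.isFourierWigner_transformLp D hp0 hp2 hS
  have hs := D.summable_sq hp0 hp2 hS
  refine ⟨⟨_, hD⟩, fun F G hF hG => hF.ae_eq hc hG,
    FourierWigner.isFourierWigner_fourierWigner, fun F hF => ?_⟩
  have hle : eLpNorm F q volume ≤ FourierWigner.schattenENorm p S := by
    -- By uniqueness `F` may be replaced by the orthogonal series.
    rw [eLpNorm_congr_ae (hF.ae_eq hc hD)]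
    have := D.countable_index hp0 hS
    obtain ⟨A, hA⟩ := exists_seq_tendsto (atTop : Filter (Finset D.ι))
    have hm := fun A =>
      (FourierWigner.memLp_fourierWigner (FourierWigner.memSchatten_one_partialSum D A)).1
    -- Convergence in `L²` gives convergence in measure, hence almost everywhere along a
    -- subsequence; the `L^q` norm is lower semicontinuous under such limits, also for `q = ∞`.
    obtain ⟨ns, -, hns⟩ := (tendstoInMeasure_of_tendsto_eLpNorm two_ne_zero (fun n => hm (A n))
      (Lp.aestronglyMeasurable _)
      ((FourierWigner.tendsto_eLpNorm_partialSum_sub D hs).comp hA)).exists_seq_tendsto_ae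
    exact Lp.eLpNorm_le_of_ae_tendsto (Eventually.of_forall fun n =>
      FourierWigner.eLpNorm_partialSum_le D hp1 hp2 hpq (A (ns n))) (fun n => hm (A (ns n))) hns
  exact ⟨⟨hF.1.1, hle.trans_lt hS⟩, hle⟩
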